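/- Let $\mathbb{M}=\mathbb{R}^2$ be $2$-dimensional Minkowski spacetime with light-cone coordinates $x^\pm=t\pm x$, metric $g=\tfrac12(\mathrm{d}x^+\otimes \mathrm{d}x^-+\mathrm{d}x^-\otimes \mathrm{d}x^+)$, orientation $\mathrm{d}x^-\wedge \mathrm{d}x^+$ and time-orientation $\mathrm{d}x^++\mathrm{d}x^-$, and let $\mathbb{M}/\mathbb{Z}$ be the flat cylinder, the quotient by the action $(n,x^\pm)\mapsto x^\pm\pm n$ with the induced structures. A subset $S$ of a spacetime $M$ is causally convex if every causal curve in $M$ with endpoints in $S$ lies in $S$. A Cauchy surface of $M$ is a subset that is met exactly once by every inextensible causal curve in $M$. The Cauchy development $D(S)\subseteq M$ is the set of all $p\in M$ such that every inextensible causal curve in $M$ through $p$ meets $S$. Let $\mathbf{C}_2$ be the category whose objects are all nonempty causally convex, connected, open subsets $U\subseteq\mathbb{M}$ and all causally convex, connected, open subsets $V\subseteq\mathbb{M}/\mathbb{Z}$ that contain a Cauchy surface of $\mathbb{M}/\mathbb{Z}$ (each with the restricted structures), and whose morphisms are the orientation and time-orientation preserving smooth embeddings $f:M\to M'$ with causally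 convex image $f(M)\subseteq M'$ and $f^*g'=\Omega^2 g$ for some $\Omega^2\in C^\infty(M,\mathbb{R}^{>0})$. A morphism $f:M\to M'$ is Cauchy if $f(M)$ contains a Cauchy surface of $M'$. Let $i:\mathbf{C}_2^D\to\mathbf{C}_2$ be the inclusion of the full subcategory on those objects that are equal to their Cauchy development in the ambient spacetime $\mathbb{M}$ or $\mathbb{M}/\mathbb{Z}$. **Proposition 3.3.** The objects of $\mathbf{C}_2^D$ are exactly the double cones $I_+\times I_-\subseteq\mathbb{M}$, with $I_\pm\subseteq\mathbb{R}$ nonempty, not necessarily bounded, open intervals (the factors being the ranges of $x^+$ and $x^-$), and the full cylinder $\mathbb{M}/\mathbb{Z}$. The fully faithful functor $i$ has a left adjoint $D:\mathbf{C}_2\to\mathbf{C}_2^D$, which sends each object to its Cauchy development in the ambient spacetime and for which the adjunction unit $M\to D(M)$ is the subset inclusion. The functor $D$ exhibits $\mathbf{C}_2^D$ as a (reflective) localization of $\mathbf{C}_2$ at the class of all Cauchy morphisms. -/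

import Mathlib

open Set Filter Topology CategoryTheory
open scoped ContDiff

noncomputable section

namespace ConformalSpacetime

/-! ### The flat Lorentzian plane in light-cone coordinates

A point (or tangent vector) `v : ℝ × ℝ` has light-cone coordinates
`v.1 = x⁺ = t + x` and `v.2 = x⁻ = t - x`. -/

/-- The Minkowski metric `g = ½ (dx⁺ ⊗ dx⁻ + dx⁻ ⊗ dx⁺) = dt² - dx²`. -/
def metric (v w : ℝ × ℝ) : ℝ := (v.1 * w.2 + v.2 * w.1) / 2

/-- The orientation `dx⁻ ∧ dx⁺`. -/
def areaForm (v w : ℝ × ℝ) : ℝ := v.2 * w.1 - v.1 * w.2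

/-- The time-orientation `dx⁺ + dx⁻`. -/
def timeForm (v : ℝ × ℝ) : ℝ := v.1 + v.2

/-- Future-directed causal (i.e. nonzero time-like or light-like) tangent vectors; the signature
is `(+,-)`. -/
def IsFutureCausal (v : ℝ × ℝ) : Prop := v ≠ 0 ∧ 0 ≤ metric v v ∧ 0 < timeForm v

/-- A linear map between tangent planes that preserves the metric up to the factor `c`
(in applications `c = Ω² > 0`), the orientation and the time-orientation. -/
structure IsOrientedConformal (c : ℝ) (L : ℝ × ℝ →L[ℝ] ℝ × ℝ) : Prop where
  conformal : ∀ v w, metric (L v) (L w) = c * metric v w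
  orientation : ∀ v w, 0 < areaForm v w → 0 < areaForm (L v) (L w)
  timeOrientation : ∀ v, IsFutureCausal v → 0 < timeForm (L v)

/-! ### The two ambient spacetimes -/

/-- The two ambient spacetimes: Minkowski spacetime and the flat cylinder. -/
inductive Background
  | minkowski
  | cylinder

namespace Background

/-- The group of translations by which the plane is divided: the trivial group for Minkowski
spacetime, and `ℤ`, acting by `(n, x^±) ↦ x^± ± n`, for the flat cylinder. -/
def deck : Background → AddSubgroup (ℝ × ℝ)
  | minkowski => ⊥
  | cylinder => AddSubgroup.zmultiples ((1, -1) : ℝ × ℝ)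

/-- The underlying topological space of Minkowski spacetime `𝕄 = ℝ²` (as the quotient by the
trivial group), resp. of the flat cylinder `𝕄/ℤ`, with the quotient topology. Its smooth
structure, metric, orientation and time-orientation are the ones induced along the covering map
`Background.proj`; the translations preserve all of them. -/
abbrev Spacetime (B : Background) : Type := (ℝ × ℝ) ⧸ B.deck

/-- The covering map from the plane onto the ambient spacetime. -/
def proj (B : Background) (x : ℝ × ℝ) : B.Spacetime := QuotientAddGroup.mk x

lemma continuous_proj (B : Background) : Continuous B.proj := continuous_quotient_mk'

lemma proj_surjective (B : Background) : Function.Surjective B.proj :=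
  QuotientAddGroup.mk_surjective

/-- Two points of the plane over the same point differ by a deck translation. -/
lemma exists_shift (B : Background) {x y : ℝ × ℝ} (h : B.proj x = B.proj y) :
    ∃ d : ℝ × ℝ, y + d = x ∧ ∀ z, B.proj (z + d) = B.proj z := by
  have h1 : -y + x ∈ B.deck := QuotientAddGroup.eq.1 h.symm
  refine ⟨-y + x, by abel, fun z => ?_⟩
  exact QuotientAddGroup.eq.2 (by simpa using B.deck.neg_mem h1)

end Background

/-! ### Causal curves, causal convexity, Cauchy surfaces and Cauchy developments -/

/-- `γ`, restricted to the interval `I` of more than one point, is a smooth future-directed causal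
curve: near each parameter it has a lift to the plane that is smooth and whose velocity is
future-directed causal. (A past-directed causal curve is a future-directed one run backwards, so
nothing is lost below by considering future-directed ones only.) -/
def IsCausalCurve {B : Background} (γ : ℝ → B.Spacetime) (I : Set ℝ) : Prop :=
  I.OrdConnected ∧ I.Nontrivial ∧ ∀ t ∈ I, ∃ l : ℝ → ℝ × ℝ,
    (∀ᶠ s in 𝓝[I] t, B.proj (l s) = γ s) ∧ ContDiffWithinAt ℝ ∞ l I t ∧
      IsFutureCausal (derivWithin l I t)

/-- A subset `S` of the open subset `U` of an ambient spacetime is causally convex in the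
spacetime `U` if every causal curve in `U` with both endpoints in `S` runs inside `S`. -/
def IsCausallyConvexIn {B : Background} (U S : Set B.Spacetime) : Prop :=
  ∀ (γ : ℝ → B.Spacetime) (a b : ℝ), IsCausalCurve γ (Icc a b) → (∀ t ∈ Icc a b, γ t ∈ U) →
    γ a ∈ S → γ b ∈ S → ∀ t ∈ Icc a b, γ t ∈ S

/-- An inextensible causal curve in the spacetime `U`: a causal curve in `U` without a future
and without a past endpoint in `U`. -/
def IsInextensibleCausalCurve {B : Background} (U : Set B.Spacetime)
    (γ : ℝ → B.Spacetime) (I : Set ℝ) : Prop :=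
  IsCausalCurve γ I ∧ (∀ t ∈ I, γ t ∈ U) ∧
    (¬ ∃ p ∈ U, Tendsto (fun t : I => γ t) atTop (𝓝 p)) ∧
    (¬ ∃ p ∈ U, Tendsto (fun t : I => γ t) atBot (𝓝 p))

/-- A Cauchy surface of the spacetime `U`: a subset of `U` that every inextensible causal curve
in `U` meets exactly once. -/
def IsCauchySurface {B : Background} (U S : Set B.Spacetime) : Prop :=
  S ⊆ U ∧ ∀ (γ : ℝ → B.Spacetime) (I : Set ℝ), IsInextensibleCausalCurve U γ I →
    ∃! t : ℝ, t ∈ I ∧ γ t ∈ S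

/-- The Cauchy development of a subset `S` of an ambient spacetime: all points `p` such that every
inextensible causal curve through `p` meets `S`. -/
def cauchyDevelopment {B : Background} (S : Set B.Spacetime) : Set B.Spacetime :=
  {p | ∀ (γ : ℝ → B.Spacetime) (I : Set ℝ), IsInextensibleCausalCurve univ γ I →
    (∃ t ∈ I, γ t = p) → ∃ t ∈ I, γ t ∈ S}

/-! ### The category `C₂` -/

/-- The objects of `C₂`: causally convex, connected, open subsets of Minkowski spacetime or of the
flat cylinder, which in the second case contain a Cauchy surface of the cylinder. -/
structure C2 where
  background : Background
  carrier : Set background.Spacetime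
  isOpen : IsOpen carrier
  isConnected : IsConnected carrier
  causallyConvex : IsCausallyConvexIn univ carrier
  cauchy : background = .cylinder → ∃ S ⊆ carrier, IsCauchySurface univ S

/-- A subset of one of the two ambient spacetimes. -/
abbrev Region : Type := Σ B : Background, Set B.Spacetime

/-- A point of one of the two ambient spacetimes. -/
abbrev Event : Type := Σ B : Background, B.Spacetime

namespace C2

/-- The subset underlying an object. -/
def region (X : C2) : Region := ⟨X.background, X.carrier⟩

/-- The Cauchy development, in the ambient spacetime, of the subset underlying an object. -/
def development (X : C2) : Region := ⟨X.background, cauchyDevelopment X.carrier⟩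

/-- A point of an object as a point of the ambient spacetime. -/
def event (X : C2) (p : X.carrier) : Event := ⟨X.background, p⟩

/-- A map between objects is a conformal, orientation and time-orientation preserving smooth map
if there is a smooth positive function `Ω²` on the source (here `c`) such that, near each point,
the map lifts to a smooth map `F` of the plane whose differential pulls the target metric back to
`Ω²` times the source metric and preserves orientation and time-orientation. -/
def IsConformalMap {X Y : C2} (f : X.carrier → Y.carrier) : Prop :=
  ∃ c : X.background.Spacetime → ℝ,
    (∀ p ∈ X.carrier, 0 < c p) ∧
    ContDiffOn ℝ ∞ (fun x => c (X.background.proj x)) (X.background.proj ⁻¹' X.carrier) ∧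
    ∀ x, X.background.proj x ∈ X.carrier → ∃ F : ℝ × ℝ → ℝ × ℝ,
      (∀ᶠ y in 𝓝 x, ∀ hy : X.background.proj y ∈ X.carrier,
        Y.background.proj (F y) = f ⟨X.background.proj y, hy⟩) ∧
      ContDiffAt ℝ ∞ F x ∧
      IsOrientedConformal (c (X.background.proj x)) (fderiv ℝ F x)

/-- The image of a map between objects, as a subset of the ambient spacetime of the target. -/
def image {X Y : C2} (f : X.carrier → Y.carrier) : Set Y.background.Spacetime :=
  Subtype.val '' range f

/-- Morphisms of `C₂`: orientation and time-orientation preserving conformal embeddings with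
causally convex image. -/
@[ext]
structure Hom (X Y : C2) where
  toFun : X.carrier → Y.carrier
  isEmbedding : IsEmbedding toFun
  isConformalMap : IsConformalMap toFun
  causallyConvex : IsCausallyConvexIn Y.carrier (image toFun)

/-! The next facts show that these morphisms compose. -/

lemma isConformalMap_id (X : C2) : IsConformalMap (id : X.carrier → X.carrier) := by
  refine ⟨fun _ => 1, fun _ _ => one_pos, contDiffOn_const, fun x hx => ⟨id, ?_, contDiffAt_id, ?_⟩⟩
  · exact Eventually.of_forall fun y hy => rfl
  · rw [fderiv_id]
    exact ⟨fun v w => by simp, fun v w h => by simpa using h, fun v h => by simpa using h.2.2⟩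

lemma IsOrientedConformal.isFutureCausal {c : ℝ} {L : ℝ × ℝ →L[ℝ] ℝ × ℝ}
    (h : IsOrientedConformal c L) (hc : 0 < c) {v : ℝ × ℝ} (hv : IsFutureCausal v) :
    IsFutureCausal (L v) := by
  have ht := h.timeOrientation v hv
  refine ⟨?_, ?_, ht⟩
  · intro h0
    simp [h0, timeForm] at ht
  · rw [h.conformal]
    exact mul_nonneg hc.le hv.2.1

lemma IsOrientedConformal.isFutureCausal_of {c : ℝ} {L : ℝ × ℝ →L[ℝ] ℝ × ℝ}
    (h : IsOrientedConformal c L) (hc : 0 < c) {v : ℝ × ℝ} (hv : IsFutureCausal (L v)) :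
    IsFutureCausal v := by
  have hv0 : v ≠ 0 := by
    rintro rfl
    exact hv.1 (map_zero L)
  have hm : 0 ≤ metric v v := by
    have := hv.2.1
    rw [h.conformal] at this
    exact nonneg_of_mul_nonneg_right this hc
  refine ⟨hv0, hm, ?_⟩
  by_contra hle
  have hle' : timeForm v ≤ 0 := not_lt.1 hle
  have hne : timeForm v ≠ 0 := by
    intro h0
    apply hv0
    simp only [timeForm, metric] at h0 hm
    have e : v.2 = -v.1 := by linarith
    rw [e] at hm
    have : v.1 = 0 := by nlinarith [sq_nonneg v.1]
    exact Prod.ext this (by simp [e, this])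
  have hneg : IsFutureCausal (-v) := by
    refine ⟨neg_ne_zero.2 hv0, ?_, ?_⟩
    · simpa [metric] using hm
    · have := lt_of_le_of_ne hle' hne
      simp only [timeForm, Prod.fst_neg, Prod.snd_neg] at this ⊢
      linarith
  have h1 := h.timeOrientation _ hneg
  have h2 := hv.2.2
  simp only [map_neg, timeForm, Prod.fst_neg, Prod.snd_neg] at h1 h2
  linarith

lemma IsOrientedConformal.injective {c : ℝ} {L : ℝ × ℝ →L[ℝ] ℝ × ℝ}
    (h : IsOrientedConformal c L) (hc : 0 < c) : Function.Injective L := by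
  rw [injective_iff_map_eq_zero]
  intro v hv
  have h1 := h.conformal v (0, 1)
  have h2 := h.conformal v (1, 0)
  rw [hv] at h1 h2
  simp [metric, hc.ne'] at h1 h2
  exact Prod.ext h1 h2

lemma isConformalMap_comp {X Y Z : C2} {g : Y.carrier → Z.carrier} {f : X.carrier → Y.carrier}
    (hg : IsConformalMap g) (hf : IsConformalMap f) : IsConformalMap (g ∘ f) := by
  classical
  obtain ⟨c, hc, hcs, hF⟩ := hf
  obtain ⟨d, hd, hds, hG⟩ := hg
  refine ⟨fun p => if h : p ∈ X.carrier then d (f ⟨p, h⟩) * c p else 0, ?_, ?_, ?_⟩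
  · intro p hp
    simp only [dif_pos hp]
    exact mul_pos (hd _ (f ⟨p, hp⟩).2) (hc p hp)
  · intro x hx
    have hx' : X.background.proj x ∈ X.carrier := hx
    obtain ⟨F, hlift, hFs, -⟩ := hF x hx'
    have hFx : Y.background.proj (F x) = f ⟨X.background.proj x, hx'⟩ := hlift.self_of_nhds hx'
    have hopen : IsOpen (Y.background.proj ⁻¹' Y.carrier) :=
      Y.isOpen.preimage Y.background.continuous_proj
    have hFmem : F x ∈ Y.background.proj ⁻¹' Y.carrier := by
      rw [mem_preimage, hFx]
      exact (f _).2
    have h1 : ContDiffAt ℝ ∞ (fun y => d (Y.background.proj (F y))) x :=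
      ContDiffAt.comp (g := fun y => d (Y.background.proj y)) x
        (hds.contDiffAt (hopen.mem_nhds hFmem)) hFs
    have hX : IsOpen (X.background.proj ⁻¹' X.carrier) :=
      X.isOpen.preimage X.background.continuous_proj
    have h2 := hcs.contDiffAt (hX.mem_nhds hx)
    refine ((h1.mul h2).congr_of_eventuallyEq ?_).contDiffWithinAt
    filter_upwards [hlift, hX.mem_nhds hx] with y hy hy'
    have hy'' : X.background.proj y ∈ X.carrier := hy'
    simp only [dif_pos hy'', hy hy'']
  · intro x hx
    obtain ⟨F, hlift, hFs, hFc⟩ := hF x hx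
    have hFx : Y.background.proj (F x) = f ⟨X.background.proj x, hx⟩ := hlift.self_of_nhds hx
    have hmem : Y.background.proj (F x) ∈ Y.carrier := by rw [hFx]; exact (f _).2
    obtain ⟨G, hGlift, hGs, hGc⟩ := hG (F x) hmem
    refine ⟨G ∘ F, ?_, hGs.comp x hFs, ?_⟩
    · filter_upwards [hlift, hFs.continuousAt.eventually hGlift] with y hy hGy hyX
      have e := hy hyX
      have hm : Y.background.proj (F y) ∈ Y.carrier := by rw [e]; exact (f _).2
      rw [Function.comp_apply, hGy hm, Function.comp_apply]
      congr 2
      exact Subtype.ext e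
    · rw [fderiv_comp x (hGs.differentiableAt (by simp)) (hFs.differentiableAt (by simp))]
      have hpos := hc _ hx
      simp only [dif_pos hx, ← hFx]
      refine ⟨fun v w => ?_, fun v w h => ?_, fun v h => ?_⟩
      · rw [ContinuousLinearMap.comp_apply, ContinuousLinearMap.comp_apply, hGc.conformal,
          hFc.conformal, mul_assoc]
      · exact hGc.orientation _ _ (hFc.orientation _ _ h)
      · exact hGc.timeOrientation _ (IsOrientedConformal.isFutureCausal hFc hpos h)

/-- A causal curve inside the image of a morphism pulls back to a causal curve. -/
lemma IsCausalCurve.pullback {X Y : C2} {f : X.carrier → Y.carrier} (hinj : Function.Injective f)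
    (hf : IsConformalMap f) {γ : ℝ → Y.background.Spacetime} {δ : ℝ → X.background.Spacetime}
    {I : Set ℝ} (hγ : IsCausalCurve γ I)
    (hδ : ∀ t ∈ I, ∃ h : δ t ∈ X.carrier, (f ⟨δ t, h⟩ : Y.background.Spacetime) = γ t) :
    IsCausalCurve δ I := by
  refine ⟨hγ.1, hγ.2.1, fun t ht => ?_⟩
  obtain ⟨c, hc, -, hF⟩ := hf
  obtain ⟨x, hx⟩ := X.background.proj_surjective (δ t)
  obtain ⟨hδt, hfδ⟩ := hδ t ht
  have hxX : X.background.proj x ∈ X.carrier := hx ▸ hδt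
  obtain ⟨F, hlift, hFs, hFc⟩ := hF x hxX
  have hFx : Y.background.proj (F x) = γ t := by
    rw [hlift.self_of_nhds hxX, ← hfδ]
    congr 2
    exact Subtype.ext hx
  obtain ⟨l, hl, hls, hlc⟩ := hγ.2.2 t ht
  have hlt : Y.background.proj (l t) = γ t := hl.self_of_nhdsWithin ht
  obtain ⟨d, hd, hdz⟩ := Y.background.exists_shift (hFx.trans hlt.symm)
  have hinjL := IsOrientedConformal.injective hFc (hc _ hxX)
  let L : (ℝ × ℝ) ≃L[ℝ] (ℝ × ℝ) :=
    (LinearEquiv.ofInjectiveEndo (fderiv ℝ F x : ℝ × ℝ →ₗ[ℝ] ℝ × ℝ) hinjL).toContinuousLinearEquiv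
  have hL : ∀ v, L v = fderiv ℝ F x v := fun v => rfl
  have hFd : HasFDerivAt F (L : ℝ × ℝ →L[ℝ] ℝ × ℝ) x :=
    (hFs.differentiableAt (by simp)).hasFDerivAt
  have hn : (∞ : WithTop ℕ∞) ≠ 0 := by simp
  have hst := hFs.hasStrictFDerivAt' hFd hn
  have hinvs := hFs.to_localInverse hFd hn
  have hinvd : HasFDerivAt (hFs.localInverse hFd hn) (L.symm : ℝ × ℝ →L[ℝ] ℝ × ℝ) (F x) :=
    hst.to_localInverse.hasFDerivAt
  have hinvx : hFs.localInverse hFd hn (F x) = x := hFs.localInverse_apply_image hFd hn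
  have hright : ∀ᶠ z in 𝓝 (F x), F (hFs.localInverse hFd hn z) = z :=
    hst.eventually_right_inverse
  generalize hFs.localInverse hFd hn = h at hinvs hinvd hinvx hright
  have hls' : ContDiffWithinAt ℝ ∞ (fun s => l s + d) I t := hls.add contDiffWithinAt_const
  have htend : Tendsto (fun s => l s + d) (𝓝[I] t) (𝓝 (F x)) := by
    have := hls'.continuousWithinAt
    rw [ContinuousWithinAt, hd] at this
    exact this
  have hXo : IsOpen (X.background.proj ⁻¹' X.carrier) :=
    X.isOpen.preimage X.background.continuous_proj
  have htend2 : Tendsto (fun s => h (l s + d)) (𝓝[I] t) (𝓝 x) := by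
    have := hinvs.continuousAt.tendsto
    rw [hinvx] at this
    exact this.comp htend
  refine ⟨fun s => h (l s + d), ?_, ?_, ?_⟩
  · filter_upwards [hl, htend.eventually hright, htend2.eventually hlift,
      htend2.eventually (hXo.mem_nhds hxX), self_mem_nhdsWithin] with s hs hrs hlifts hmem hsI
    obtain ⟨h1, h2⟩ := hδ s hsI
    have h3 := hlifts hmem
    rw [hrs, hdz, hs, ← h2] at h3
    exact (congrArg Subtype.val (hinj (Subtype.ext h3))).symm
  · have : ContDiffAt ℝ ∞ h (l t + d) := by rw [hd]; exact hinvs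
    exact ContDiffAt.comp_contDiffWithinAt t this hls'
  · have hu : UniqueDiffWithinAt ℝ I t := by
      have hconv : Convex ℝ I := hγ.1.convex
      refine uniqueDiffWithinAt_convex hconv ?_ (subset_closure ht)
      obtain ⟨a, ha, b, hb, hab⟩ := hγ.2.1.exists_lt
      refine ⟨(a + b) / 2, mem_interior.2 ⟨Ioo a b, ?_, isOpen_Ioo, by constructor <;> linarith⟩⟩
      exact fun z hz => hγ.1.out ha hb ⟨hz.1.le, hz.2.le⟩
    have hld : HasDerivWithinAt (fun s => l s + d) (derivWithin l I t) I t :=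
      (hls.differentiableWithinAt (by simp)).hasDerivWithinAt.add_const d
    have hcomp : HasDerivWithinAt (fun s => h (l s + d)) (L.symm (derivWithin l I t)) I t :=
      HasFDerivAt.comp_hasDerivWithinAt_of_eq t hinvd hld hd.symm
    rw [hcomp.derivWithin hu]
    apply IsOrientedConformal.isFutureCausal_of hFc (hc _ hxX)
    rw [← hL, ContinuousLinearEquiv.apply_symm_apply]
    exact hlc

lemma image_id (X : C2) : image (id : X.carrier → X.carrier) = X.carrier := by
  simp [image]

lemma causallyConvex_comp {X Y Z : C2} (f : Hom X Y) (g : Hom Y Z) :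
    IsCausallyConvexIn Z.carrier (image (g.toFun ∘ f.toFun)) := by
  classical
  intro γ a b hγ hγZ ha hb
  have hsub : image (g.toFun ∘ f.toFun) ⊆ image g.toFun :=
    image_mono (range_comp_subset_range _ _)
  have hg := g.causallyConvex γ a b hγ hγZ (hsub ha) (hsub hb)
  have hex : ∀ t, ∃ p : Y.background.Spacetime, t ∈ Icc a b →
      ∃ h : p ∈ Y.carrier, (g.toFun ⟨p, h⟩ : Z.background.Spacetime) = γ t := by
    intro t
    by_cases ht : t ∈ Icc a b
    · obtain ⟨-, ⟨p, rfl⟩, hp⟩ := hg t ht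
      exact ⟨p, fun _ => ⟨p.2, hp⟩⟩
    · exact ⟨Y.background.proj 0, fun h => absurd h ht⟩
  choose δ hδ using hex
  have hδc : IsCausalCurve δ (Icc a b) :=
    IsCausalCurve.pullback g.isEmbedding.injective g.isConformalMap hγ hδ
  have key : ∀ t ∈ Icc a b, γ t ∈ image (g.toFun ∘ f.toFun) → δ t ∈ image f.toFun := by
    rintro t ht ⟨-, ⟨x, rfl⟩, hx⟩
    obtain ⟨h1, h2⟩ := hδ t ht
    refine ⟨f.toFun x, ⟨x, rfl⟩, ?_⟩
    have := g.isEmbedding.injective (Subtype.ext (hx.trans h2.symm))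
    exact congrArg Subtype.val this
  have hab : a ≤ b := by
    obtain ⟨z, hz⟩ := hγ.2.1.nonempty
    exact hz.1.trans hz.2
  intro t ht
  obtain ⟨-, ⟨x, rfl⟩, hx⟩ := f.causallyConvex δ a b hδc (fun s hs => (hδ s hs).1)
    (key a (left_mem_Icc.2 hab) ha) (key b (right_mem_Icc.2 hab) hb) t ht
  obtain ⟨h1, h2⟩ := hδ t ht
  refine ⟨g.toFun (f.toFun x), ⟨x, rfl⟩, ?_⟩
  rw [← h2]
  congr 2
  exact Subtype.ext hx

instance : Category C2 where
  Hom := Hom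
  id X := ⟨id, IsEmbedding.id, isConformalMap_id X, by
    rw [image_id]
    exact fun γ a b _ h _ _ => h⟩
  comp f g := ⟨g.toFun ∘ f.toFun, g.isEmbedding.comp f.isEmbedding,
    isConformalMap_comp g.isConformalMap f.isConformalMap, causallyConvex_comp f g⟩

/-- The map of points underlying a morphism. -/
def map {X Y : C2} (f : X ⟶ Y) : X.carrier → Y.carrier := Hom.toFun f

/-- The Cauchy morphisms: those whose image contains a Cauchy surface of the target. -/
def cauchyMorphisms : MorphismProperty C2 := fun _ Y f =>
  ∃ S ⊆ image (map f), IsCauchySurface Y.carrier S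

/-- The objects that are stable under Cauchy development in their ambient spacetime. They form
the full subcategory `C₂ᴰ`. -/
def cauchyStable : ObjectProperty C2 := fun X => X.development = X.region

/-- The double cone `I₊ × I₋` in Minkowski spacetime. -/
def doubleCone (Ip Im : Set ℝ) : Region :=
  ⟨.minkowski, Background.minkowski.proj '' (Ip ×ˢ Im)⟩

/-- Nonempty, not necessarily bounded, open intervals. -/
def IsOpenInterval (I : Set ℝ) : Prop := I.Nonempty ∧ IsOpen I ∧ I.OrdConnected

end C2

end ConformalSpacetime

end

/-!
Every object `X` is studied through its preimage `X.cover` in the plane with coordinates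
`(x⁺, x⁻)`. Lifts of causal curves are exactly the curves along which both coordinates are
nondecreasing and their sum increases, so an open set is causally convex if and only if its preimage
is convex for the product order (`ordConnected_preimage`,
`isCausallyConvexIn_univ_of_ordConnected`). Consequently `X.cover` is open, order convex and
connected; let `X.plus` and `X.minus` be the intervals which are its projections.

The Cauchy development of `X` is the projection of the box `X.plus × X.minus`
(`C2.cauchyDevelopment_carrier`). A point outside of the box lies on a null line that misses `X`.
For a point `p` of the box, both null lines through `p` meet the cover. Either `p` lies between two
such meeting points, hence in `X`, or the meeting points lie on different sides of every
inextensible causal curve through `p`, which therefore has to cross the connected set `X`. For an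
object in the cylinder both intervals are all of `ℝ`, because every null line meets the Cauchy
surface. This gives the stable objects.

A conformal map preserves each of the two families of null lines, so it lifts to a product
`k₁ × k₂` of smooth functions of one coordinate with positive derivatives
(`C2.IsConformalMap.exists_isLift`). This product is defined on the whole box and is unique up to
deck translations, which gives at most one extension of a morphism to the Cauchy development.
That the extension is again injective with causally convex image is clear if the target is
Minkowski spacetime. In the cylinder it rests on
`C2.IsLift.exists_deck_of_isPreconnected`: the preimage of the image of a morphism is order convex
and is a union of translates of one open set, any two of which are equal or disjoint. A segment
along a null line stays in one of them; hence if the ranges of `k₁` or of `k₂` in two translates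
overlap, then these translates are equal. So stable objects form a reflective subcategory with the
inclusions `C2.toCompletion` as units.

For the localization property it is enough that Cauchy morphisms are inverted and that the units are
Cauchy. A null line in the target of a Cauchy morphism meets the image, so by the same dichotomy of
translates `k₁` and `k₂` are onto, and the extension to the Cauchy developments has a smooth inverse
(`C2.isIso_of_cauchyMorphisms`). Conversely, `X` contains a Cauchy surface of its Cauchy
development: in the cylinder by definition, and in Minkowski spacetime by Geroch's
construction, as the set of points whose past and future in `X.cover` have the same measure
(`C2.isCauchySurface_balance`).
-/

noncomputable section

namespace ConformalSpacetime

/-! ### The covering of the ambient spacetime by the plane -/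

/-- A function that is locally constant on a preconnected set is constant there. -/
lemma eq_of_eventually_eq {E Y : Type*} [TopologicalSpace E] {s : Set E} (hs : IsPreconnected s)
    {f : E → Y} (h : ∀ x ∈ s, ∀ᶠ y in 𝓝[s] x, f y = f x) {x y : E} (hx : x ∈ s) (hy : y ∈ s) :
    f x = f y := by
  let : TopologicalSpace Y := ⊥
  have : DiscreteTopology Y := ⟨rfl⟩
  refine hs.constant (f := f) (fun z hz => ?_) hx hy
  rw [ContinuousWithinAt, nhds_discrete, tendsto_pure]
  exact h z hz

namespace Background

variable {B : Background}

lemma sum_eq_zero_of_mem_deck {d : ℝ × ℝ} (hd : d ∈ B.deck) : d.1 + d.2 = 0 := by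
  cases B with
  | minkowski =>
    have : d = 0 := hd
    simp [this]
  | cylinder =>
    obtain ⟨n, rfl⟩ := AddSubgroup.mem_zmultiples_iff.1 hd
    simp

lemma eq_zero_of_mem_deck {d : ℝ × ℝ} (hd : d ∈ B.deck) (h : ‖d‖ < 1) : d = 0 := by
  cases B with
  | minkowski => exact hd
  | cylinder =>
    obtain ⟨n, rfl⟩ := AddSubgroup.mem_zmultiples_iff.1 hd
    have h1 : |(n : ℝ)| < 1 := by
      have := (norm_fst_le (n • ((1, -1) : ℝ × ℝ))).trans_lt h
      simpa using this
    have h2 : n = 0 := by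
      have : |n| < 1 := by exact_mod_cast h1
      exact Int.abs_lt_one_iff.1 this
    simp [h2]

lemma proj_eq_iff {x y : ℝ × ℝ} : B.proj x = B.proj y ↔ y - x ∈ B.deck := by
  rw [show y - x = -x + y by abel]
  exact QuotientAddGroup.eq

lemma proj_add (x : ℝ × ℝ) {d : ℝ × ℝ} (hd : d ∈ B.deck) : B.proj (x + d) = B.proj x :=
  proj_eq_iff.2 (by simpa using B.deck.neg_mem hd)

lemma proj_injective (hB : B = minkowski) : Function.Injective B.proj := by
  subst hB
  intro x y hxy
  exact (sub_eq_zero.1 (show y - x = 0 from proj_eq_iff.1 hxy)).symm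

lemma isOpenMap_proj (B : Background) : IsOpenMap B.proj := QuotientAddGroup.isOpenMap_coe

lemma isDiscrete_deck (B : Background) : _root_.IsDiscrete (B.deck : Set (ℝ × ℝ)) := by
  constructor
  refine discreteTopology_of_isOpen_singleton_zero (G := B.deck) ?_
  have h : ({0} : Set B.deck) = Subtype.val ⁻¹' Metric.ball (0 : ℝ × ℝ) 1 := by
    ext d
    constructor
    · rintro rfl
      simp
    · intro hd
      exact Subtype.ext (eq_zero_of_mem_deck d.2 (by simpa using hd))
  rw [h]
  exact Metric.isOpen_ball.preimage continuous_subtype_val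

instance : DiscreteTopology B.deck := B.isDiscrete_deck.1

instance : T2Space B.Spacetime :=
  haveI : IsClosed (B.deck : Set (ℝ × ℝ)) := AddSubgroup.isClosed_of_discrete
  inferInstance

lemma isCoveringMap_proj (B : Background) : IsCoveringMap B.proj :=
  (AddSubgroup.isAddQuotientCoveringMap_of_comm B.deck B.isDiscrete_deck).isCoveringMap

/-- Twice the time coordinate, `x⁺ + x⁻`, as a function on the ambient spacetime. -/
def time (B : Background) : B.Spacetime → ℝ :=
  Quotient.lift (fun x : ℝ × ℝ => x.1 + x.2) fun x y h => by
    have := sum_eq_zero_of_mem_deck (QuotientAddGroup.leftRel_apply.1 h)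
    simp only [Prod.fst_add, Prod.snd_add, Prod.fst_neg, Prod.snd_neg] at this
    linarith

lemma time_proj (x : ℝ × ℝ) : B.time (B.proj x) = x.1 + x.2 := rfl

lemma continuous_time (B : Background) : Continuous B.time :=
  Continuous.quotient_lift (continuous_fst.add continuous_snd) _

/-- Two continuous lifts of the same map differ by a locally constant deck translation. -/
lemma eventually_sub_eq {E : Type*} [TopologicalSpace E] {s : Set E} {x : E} {F G : E → ℝ × ℝ}
    (hx : x ∈ s) (hF : ContinuousWithinAt F s x) (hG : ContinuousWithinAt G s x)
    (h : ∀ᶠ y in 𝓝[s] x, B.proj (F y) = B.proj (G y)) :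
    ∀ᶠ y in 𝓝[s] x, F y - G y = F x - G x := by
  have h0 := h.self_of_nhdsWithin hx
  have hc : ∀ᶠ y in 𝓝[s] x, F y - G y ∈ Metric.ball (F x - G x) 1 :=
    (hF.sub hG).eventually (Metric.ball_mem_nhds _ one_pos)
  filter_upwards [h, hc] with y hy hyc
  have h1 := B.deck.sub_mem (proj_eq_iff.1 hy) (proj_eq_iff.1 h0)
  rw [mem_ball_iff_norm] at hyc
  have h2 := eq_zero_of_mem_deck h1 (by
    rwa [show G y - F y - (G x - F x) = -(F y - G y - (F x - G x)) by abel, norm_neg])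
  rw [sub_eq_zero] at h2
  rw [← neg_sub, h2, neg_sub]

/-- If `g` has, near each point of a preconnected set, a lift that differs from `h` by a constant,
then it agrees, up to one constant, with the projection of `h`. -/
lemma exists_const_of_locally {E : Type*} [TopologicalSpace E] {s : Set E} (hs : IsPreconnected s)
    {g : E → B.Spacetime} {h : E → ℝ × ℝ}
    (H : ∀ x ∈ s, ∃ c : ℝ × ℝ, ∀ᶠ y in 𝓝[s] x, g y = B.proj (h y + c)) :
    ∃ c : ℝ × ℝ, ∀ x ∈ s, g x = B.proj (h x + c) := by
  rcases s.eq_empty_or_nonempty with rfl | ⟨x₀, hx₀⟩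
  · exact ⟨0, by simp⟩
  have hconst : ∀ x ∈ s, g x - B.proj (h x) = g x₀ - B.proj (h x₀) := by
    intro x hx
    refine eq_of_eventually_eq hs (f := fun x => g x - B.proj (h x)) (fun z hz => ?_) hx hx₀
    obtain ⟨c, hc⟩ := H z hz
    have key : ∀ y, g y = B.proj (h y + c) → g y - B.proj (h y) = B.proj c := fun y hy => by
      rw [hy, show B.proj (h y + c) = B.proj (h y) + B.proj c from rfl]
      abel
    filter_upwards [hc] with y hy
    rw [key y hy, key z (hc.self_of_nhdsWithin hz)]
  obtain ⟨c, hc⟩ := B.proj_surjective (g x₀ - B.proj (h x₀))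
  refine ⟨c, fun x hx => ?_⟩
  rw [show B.proj (h x + c) = B.proj (h x) + B.proj c from rfl, hc, ← hconst x hx]
  abel

lemma exists_lift_of_isOpen {I : Set ℝ} (hI : I.OrdConnected) (hne : I.Nonempty) (ho : IsOpen I)
    {γ : ℝ → B.Spacetime} (hγ : ContinuousOn γ I) :
    ∃ l : ℝ → ℝ × ℝ, ContinuousOn l I ∧ ∀ t ∈ I, B.proj (l t) = γ t := by
  classical
  have := ho.locallyPathConnectedSpace
  have : ContractibleSpace I := hI.convex.contractibleSpace hne
  obtain ⟨t₀, ht₀⟩ := hne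
  obtain ⟨e, he⟩ := B.proj_surjective (γ t₀)
  obtain ⟨F, ⟨-, hF⟩, -⟩ := B.isCoveringMap_proj.existsUnique_continuousMap_lifts
    ⟨I.domRestrict γ, hγ.domRestrict⟩ ⟨t₀, ht₀⟩ e he
  refine ⟨fun t => if h : t ∈ I then F ⟨t, h⟩ else 0, ?_, fun t ht => ?_⟩
  · rw [continuousOn_iff_continuous_domRestrict]
    convert F.continuous using 1
    ext t <;> simp
  · have := congrFun hF ⟨t, ht⟩
    simp only [ht, dite_true]
    exact this

lemma exists_lift_Icc {a b : ℝ} (hab : a ≤ b) {γ : ℝ → B.Spacetime}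
    (hγ : ContinuousOn γ (Icc a b)) :
    ∃ l : ℝ → ℝ × ℝ, ContinuousOn l (Icc a b) ∧ ∀ t ∈ Icc a b, B.proj (l t) = γ t := by
  obtain ⟨l, hl, h⟩ := exists_lift_of_isOpen (B := B) (γ := IccExtend hab ((Icc a b).domRestrict γ))
    ordConnected_univ ⟨0, trivial⟩ isOpen_univ (hγ.domRestrict.Icc_extend').continuousOn
  refine ⟨l, hl.mono (subset_univ _), fun t ht => ?_⟩
  rw [h t trivial, IccExtend_of_mem _ _ ht]
  rfl

end Background

/-! ### Causal curves, and causal convexity as order convexity in the plane -/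

lemma isFutureCausal_iff {v : ℝ × ℝ} : IsFutureCausal v ↔ 0 ≤ v ∧ 0 < v.1 + v.2 := by
  constructor
  · rintro ⟨-, h1, h2⟩
    simp only [metric, timeForm] at h1 h2
    refine ⟨⟨?_, ?_⟩, h2⟩ <;> by_contra! h <;> dsimp at h <;> nlinarith
  · rintro ⟨⟨h1, h2⟩, h3⟩
    refine ⟨?_, ?_, h3⟩
    · rintro rfl
      exact absurd h3 (by simp)
    · have := mul_nonneg h1 h2
      simp only [metric]
      linarith

lemma hasDerivAt_fst_of {l : ℝ → ℝ × ℝ} {v : ℝ × ℝ} {t : ℝ} (h : HasDerivAt l v t) :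
    HasDerivAt (fun s => (l s).1) v.1 t :=
  (ContinuousLinearMap.fst ℝ ℝ ℝ).hasFDerivAt.comp_hasDerivAt t h

lemma hasDerivAt_snd_of {l : ℝ → ℝ × ℝ} {v : ℝ × ℝ} {t : ℝ} (h : HasDerivAt l v t) :
    HasDerivAt (fun s => (l s).2) v.2 t :=
  (ContinuousLinearMap.snd ℝ ℝ ℝ).hasFDerivAt.comp_hasDerivAt t h

section Curves

variable {B : Background} {γ : ℝ → B.Spacetime} {I : Set ℝ}

lemma IsCausalCurve.continuousOn (hγ : IsCausalCurve γ I) : ContinuousOn γ I := by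
  intro t ht
  obtain ⟨l, hl, hls, -⟩ := hγ.2.2 t ht
  have h : ContinuousWithinAt (fun s => B.proj (l s)) I t :=
    B.continuous_proj.continuousAt.comp_continuousWithinAt hls.continuousWithinAt
  exact h.congr_of_eventuallyEq (hl.mono fun s hs => hs.symm) (hl.self_of_nhdsWithin ht).symm

lemma IsCausalCurve.hasDerivAt_of_lift (hγ : IsCausalCurve γ I) {l : ℝ → ℝ × ℝ}
    (hl : ContinuousOn l I) (hlγ : ∀ t ∈ I, B.proj (l t) = γ t) {t : ℝ} (ht : t ∈ interior I) :
    ∃ v, IsFutureCausal v ∧ HasDerivAt l v t := by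
  have htI := interior_subset ht
  obtain ⟨m, hm, hms, hmc⟩ := hγ.2.2 t htI
  have h := Background.eventually_sub_eq (B := B) htI (hl t htI) hms.continuousWithinAt (by
    filter_upwards [hm, self_mem_nhdsWithin] with s hs hsI
    rw [hs, hlγ s hsI])
  have hn : 𝓝[I] t = 𝓝 t := nhdsWithin_eq_nhds.2 (mem_interior_iff_mem_nhds.1 ht)
  have hd : HasDerivWithinAt m (derivWithin m I t) I t :=
    (hms.differentiableWithinAt (by simp)).hasDerivWithinAt
  refine ⟨_, hmc, ?_⟩
  have hd' := (hd.hasDerivAt (mem_interior_iff_mem_nhds.1 ht)).add_const (l t - m t)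
  refine hd'.congr_of_eventuallyEq ?_
  rw [hn] at h
  filter_upwards [h] with s hs
  rw [← hs]
  abel

/-- A causal curve lifts to the plane, and both light-cone coordinates of the lift are
nondecreasing. -/
lemma IsCausalCurve.exists_lift (hγ : IsCausalCurve γ I) (hI : IsOpen I ∨ ∃ a b, I = Icc a b) :
    ∃ l : ℝ → ℝ × ℝ, ContinuousOn l I ∧ (∀ t ∈ I, B.proj (l t) = γ t) ∧ MonotoneOn l I ∧
      StrictMonoOn (fun t => (l t).1 + (l t).2) I := by
  obtain ⟨l, hl, hlγ⟩ : ∃ l : ℝ → ℝ × ℝ, ContinuousOn l I ∧ ∀ t ∈ I, B.proj (l t) = γ t := by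
    rcases hI with hI | ⟨a, b, rfl⟩
    · exact Background.exists_lift_of_isOpen hγ.1 hγ.2.1.nonempty hI hγ.continuousOn
    · obtain ⟨z, hz⟩ := hγ.2.1.nonempty
      exact Background.exists_lift_Icc (hz.1.trans hz.2) hγ.continuousOn
  have hconv : Convex ℝ I := hγ.1.convex
  have hd := fun t ht => hγ.hasDerivAt_of_lift hl hlγ (t := t) ht
  refine ⟨l, hl, hlγ, fun s hs t ht hst => ⟨?_, ?_⟩, ?_⟩
  · refine monotoneOn_of_deriv_nonneg hconv (continuous_fst.comp_continuousOn hl) (fun t ht => ?_)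
      (fun t ht => ?_) hs ht hst
    · obtain ⟨v, -, hv⟩ := hd t ht
      exact (hasDerivAt_fst_of hv).differentiableAt.differentiableWithinAt
    · obtain ⟨v, hvc, hv⟩ := hd t ht
      exact (hasDerivAt_fst_of hv).deriv.symm ▸ (isFutureCausal_iff.1 hvc).1.1
  · refine monotoneOn_of_deriv_nonneg hconv (continuous_snd.comp_continuousOn hl) (fun t ht => ?_)
      (fun t ht => ?_) hs ht hst
    · obtain ⟨v, -, hv⟩ := hd t ht
      exact (hasDerivAt_snd_of hv).differentiableAt.differentiableWithinAt
    · obtain ⟨v, hvc, hv⟩ := hd t ht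
      exact (hasDerivAt_snd_of hv).deriv.symm ▸ (isFutureCausal_iff.1 hvc).1.2
  · refine strictMonoOn_of_deriv_pos hconv
      ((continuous_fst.comp_continuousOn hl).add (continuous_snd.comp_continuousOn hl))
      (fun t ht => ?_)
    obtain ⟨v, hvc, hv⟩ := hd t ht
    exact ((hasDerivAt_fst_of hv).add (hasDerivAt_snd_of hv)).deriv.symm ▸
      (isFutureCausal_iff.1 hvc).2

lemma isCausalCurve_proj (B : Background) {l : ℝ → ℝ × ℝ} (hl : ContDiff ℝ ∞ l)
    (hc : ∀ t, IsFutureCausal (deriv l t)) {I : Set ℝ} (hI : I.OrdConnected) (hn : I.Nontrivial) :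
    IsCausalCurve (fun t => B.proj (l t)) I := by
  refine ⟨hI, hn, fun t ht => ⟨l, Eventually.of_forall fun _ => rfl, hl.contDiffWithinAt, ?_⟩⟩
  have hu : UniqueDiffWithinAt ℝ I t := by
    refine uniqueDiffWithinAt_convex hI.convex ?_ (subset_closure ht)
    obtain ⟨a, ha, b, hb, hab⟩ := hn.exists_lt
    refine ⟨(a + b) / 2, mem_interior.2 ⟨Ioo a b, ?_, isOpen_Ioo, by constructor <;> linarith⟩⟩
    exact fun z hz => hI.out ha hb ⟨hz.1.le, hz.2.le⟩
  rw [((hl.differentiable (by simp)) t).hasDerivAt.hasDerivWithinAt.derivWithin hu]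
  exact hc t

lemma isCausalCurve_graph (B : Background) {h : ℝ → ℝ} (hs : ContDiff ℝ ∞ h) (hm : Monotone h)
    {I : Set ℝ} (hI : I.OrdConnected) (hn : I.Nontrivial) :
    IsCausalCurve (fun t => B.proj (t, h t)) I := by
  refine isCausalCurve_proj B (contDiff_id.prodMk hs) (fun t => ?_) hI hn
  have hd : HasDerivAt (fun t => (t, h t)) (1, deriv h t) t :=
    (hasDerivAt_id t).prodMk ((hs.differentiable (by simp)) t).hasDerivAt
  have hnn : 0 ≤ deriv h t := hm.deriv_nonneg
  rw [isFutureCausal_iff]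
  erw [hd.deriv]
  exact ⟨⟨zero_le_one, hnn⟩, add_pos_of_pos_of_nonneg one_pos hnn⟩

/-- A null line `x⁺ = c`. -/
lemma isCausalCurve_const_fst (B : Background) (c : ℝ) {I : Set ℝ} (hI : I.OrdConnected)
    (hn : I.Nontrivial) : IsCausalCurve (fun t => B.proj (c, t)) I := by
  refine isCausalCurve_proj B (contDiff_const.prodMk contDiff_id) (fun t => ?_) hI hn
  have hd : HasDerivAt (fun t : ℝ => (c, t)) (0, 1) t :=
    (hasDerivAt_const t c).prodMk (hasDerivAt_id t)
  rw [isFutureCausal_iff]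
  erw [hd.deriv]
  exact ⟨⟨le_rfl, zero_le_one⟩, by norm_num⟩

/-- A null line `x⁻ = c`. -/
lemma isCausalCurve_const_snd (B : Background) (c : ℝ) {I : Set ℝ} (hI : I.OrdConnected)
    (hn : I.Nontrivial) : IsCausalCurve (fun t => B.proj (t, c)) I :=
  isCausalCurve_graph B contDiff_const monotone_const hI hn

lemma exists_pos_shift_mem {W : Set (ℝ × ℝ)} (hW : IsOpen W) {x : ℝ × ℝ} (hx : x ∈ W) :
    ∃ ε > 0, (x.1 - ε, x.2 - ε) ∈ W ∧ (x.1 + ε, x.2 + ε) ∈ W := by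
  obtain ⟨δ, hδ, h⟩ := Metric.isOpen_iff.1 hW x hx
  refine ⟨δ / 2, half_pos hδ, h ?_, h ?_⟩
  all_goals
    rw [mem_ball_iff_norm, Prod.norm_def]
    simp [abs_of_pos hδ, hδ]

/-- The preimage in the plane of an open causally convex set is convex for the product order: two
points of it can first be moved apart a little, and then any point between them lies on the graph
of a smooth monotone function through both. -/
lemma ordConnected_preimage {S : Set B.Spacetime} (ho : IsOpen S)
    (h : IsCausallyConvexIn univ S) : (B.proj ⁻¹' S).OrdConnected := by
  refine ⟨fun r hr q hq p hp => ?_⟩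
  have hW : IsOpen (B.proj ⁻¹' S) := ho.preimage B.continuous_proj
  obtain ⟨ε, hε, hr', -⟩ := exists_pos_shift_mem hW hr
  obtain ⟨δ, hδ, -, hq'⟩ := exists_pos_shift_mem hW hq
  have h1 := hp.1.1
  have h2 := hp.1.2
  have h3 := hp.2.1
  have h4 := hp.2.2
  set a := r.1 - ε with ha
  set a' := r.2 - ε with ha'
  set b := q.1 + δ with hb
  set b' := q.2 + δ with hb'
  have hap : 0 < p.1 - a := by linarith
  have hpb : 0 < b - p.1 := by linarith
  -- a smooth monotone function with `k a = a'`, `k p.1 = p.2` and `k b = b'`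
  let k : ℝ → ℝ := fun t => a' + (p.2 - a') * Real.smoothTransition ((t - a) / (p.1 - a)) +
    (b' - p.2) * Real.smoothTransition ((t - p.1) / (b - p.1))
  have hks : ContDiff ℝ ∞ k := by
    have h1 : ContDiff ℝ ∞ (fun t : ℝ => (t - a) / (p.1 - a)) :=
      (contDiff_id.sub contDiff_const).div_const _
    have h2 : ContDiff ℝ ∞ (fun t : ℝ => (t - p.1) / (b - p.1)) :=
      (contDiff_id.sub contDiff_const).div_const _
    exact (contDiff_const.add (contDiff_const.mul (Real.smoothTransition.contDiff.comp h1))).add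
      (contDiff_const.mul (Real.smoothTransition.contDiff.comp h2))
  have hkm : Monotone k := by
    intro s t hst
    have e1 := Real.smoothTransition.monotone (show (s - a) / (p.1 - a) ≤ (t - a) / (p.1 - a) by
      gcongr)
    have e2 := Real.smoothTransition.monotone
      (show (s - p.1) / (b - p.1) ≤ (t - p.1) / (b - p.1) by gcongr)
    have e3 := mul_le_mul_of_nonneg_left e1 (show 0 ≤ p.2 - a' by linarith)
    have e4 := mul_le_mul_of_nonneg_left e2 (show 0 ≤ b' - p.2 by linarith)
    simp only [k]
    linarith
  have ka : k a = a' := by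
    have : (a - p.1) / (b - p.1) ≤ 0 := div_nonpos_of_nonpos_of_nonneg (by linarith) hpb.le
    simp [k, Real.smoothTransition.zero_of_nonpos this]
  have kp : k p.1 = p.2 := by
    simp [k, div_self hap.ne']
  have kb : k b = b' := by
    have : 1 ≤ (b - a) / (p.1 - a) := (one_le_div hap).2 (by linarith)
    simp [k, Real.smoothTransition.one_of_one_le this, div_self hpb.ne']
  have hab : a < b := by linarith
  have := h (fun t => B.proj (t, k t)) a b
    (isCausalCurve_graph B hks hkm ordConnected_Icc
      ⟨a, left_mem_Icc.2 hab.le, b, right_mem_Icc.2 hab.le, hab.ne⟩) (fun _ _ => trivial)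
    (by rw [ka]; exact hr') (by rw [kb]; exact hq') p.1 ⟨by linarith, by linarith⟩
  rwa [kp] at this

lemma isCausallyConvexIn_univ_of_ordConnected {S : Set B.Spacetime}
    (h : (B.proj ⁻¹' S).OrdConnected) : IsCausallyConvexIn univ S := by
  intro γ a b hγ _ ha hb t ht
  have hab := ht.1.trans ht.2
  obtain ⟨l, -, hlγ, hm, -⟩ := hγ.exists_lift (Or.inr ⟨a, b, rfl⟩)
  have hla : l a ∈ B.proj ⁻¹' S := by rwa [mem_preimage, hlγ a (left_mem_Icc.2 hab)]
  have hlb : l b ∈ B.proj ⁻¹' S := by rwa [mem_preimage, hlγ b (right_mem_Icc.2 hab)]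
  have := h.out hla hlb
    ⟨hm (left_mem_Icc.2 hab) ht ht.1, hm ht (right_mem_Icc.2 hab) ht.2⟩
  rwa [mem_preimage, hlγ t ht] at this

lemma IsCausallyConvexIn.trans {U S : Set B.Spacetime} (hU : IsCausallyConvexIn univ U)
    (hS : IsCausallyConvexIn U S) (hSU : S ⊆ U) : IsCausallyConvexIn univ S :=
  fun γ a b hγ _ ha hb => hS γ a b hγ (hU γ a b hγ (fun _ _ => trivial) (hSU ha) (hSU hb)) ha hb

lemma IsCausallyConvexIn.restrict {U S : Set B.Spacetime} (hS : IsCausallyConvexIn univ S) :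
    IsCausallyConvexIn U S := fun γ a b hγ _ =>
  hS γ a b hγ (fun _ _ => trivial)

end Curves

/-! ### Inextensible causal curves -/

lemma exists_isLUB_tendsto {ι : Type*} [Preorder ι] [Nonempty ι] {f : ι → ℝ × ℝ} (hf : Monotone f)
    {M : ℝ × ℝ} (hM : ∀ i, f i ≤ M) : ∃ p, IsLUB (range f) p ∧ Tendsto f atTop (𝓝 p) := by
  have h1 : BddAbove (range fun i => (f i).1) := ⟨M.1, by rintro - ⟨i, rfl⟩; exact (hM i).1⟩
  have h2 : BddAbove (range fun i => (f i).2) := ⟨M.2, by rintro - ⟨i, rfl⟩; exact (hM i).2⟩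
  have h : IsLUB (range f) (⨆ i, (f i).1, ⨆ i, (f i).2) := by
    refine ⟨?_, fun q hq => ⟨ciSup_le fun i => (hq ⟨i, rfl⟩).1, ciSup_le fun i => (hq ⟨i, rfl⟩).2⟩⟩
    rintro - ⟨i, rfl⟩
    exact ⟨le_ciSup h1 i, le_ciSup h2 i⟩
  exact ⟨_, h, tendsto_atTop_isLUB hf h⟩

lemma exists_isGLB_tendsto {ι : Type*} [Preorder ι] [Nonempty ι] {f : ι → ℝ × ℝ} (hf : Monotone f)
    {M : ℝ × ℝ} (hM : ∀ i, M ≤ f i) : ∃ p, IsGLB (range f) p ∧ Tendsto f atBot (𝓝 p) := by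
  have h1 : BddBelow (range fun i => (f i).1) := ⟨M.1, by rintro - ⟨i, rfl⟩; exact (hM i).1⟩
  have h2 : BddBelow (range fun i => (f i).2) := ⟨M.2, by rintro - ⟨i, rfl⟩; exact (hM i).2⟩
  have h : IsGLB (range f) (⨅ i, (f i).1, ⨅ i, (f i).2) := by
    refine ⟨?_, fun q hq => ⟨le_ciInf fun i => (hq ⟨i, rfl⟩).1, le_ciInf fun i => (hq ⟨i, rfl⟩).2⟩⟩
    rintro - ⟨i, rfl⟩
    exact ⟨ciInf_le h1 i, ciInf_le h2 i⟩
  exact ⟨_, h, tendsto_atBot_isGLB hf h⟩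

section Inextensible

variable {B : Background} {γ : ℝ → B.Spacetime} {I : Set ℝ} {U : Set B.Spacetime}

lemma IsInextensibleCausalCurve.isOpen (h : IsInextensibleCausalCurve U γ I) : IsOpen I := by
  obtain ⟨hγ, hU, htop, hbot⟩ := h
  rw [isOpen_iff_mem_nhds]
  intro t ht
  obtain ⟨s, hs, hts⟩ : ∃ s ∈ I, t < s := by
    by_contra! hmax
    refine htop ⟨γ t, hU t ht, tendsto_atTop_of_eventually_const (i₀ := ⟨t, ht⟩) fun i hi => ?_⟩
    rw [le_antisymm (hmax i i.2) hi]
  obtain ⟨r, hr, hrt⟩ : ∃ r ∈ I, r < t := by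
    by_contra! hmin
    refine hbot ⟨γ t, hU t ht, tendsto_atBot_of_eventually_const (i₀ := ⟨t, ht⟩) fun i hi => ?_⟩
    rw [le_antisymm hi (hmin i i.2)]
  exact mem_of_superset (Ioo_mem_nhds hrt hts) fun z hz => hγ.1.out hr hs ⟨hz.1.le, hz.2.le⟩

/-- An inextensible causal curve lifts to a monotone curve in the plane. If the lift is bounded
above (below), then its endpoint does not project into the spacetime. -/
lemma IsInextensibleCausalCurve.exists_lift (h : IsInextensibleCausalCurve U γ I) :
    ∃ l : ℝ → ℝ × ℝ, ContinuousOn l I ∧ (∀ t ∈ I, B.proj (l t) = γ t) ∧ MonotoneOn l I ∧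
      StrictMonoOn (fun t => (l t).1 + (l t).2) I ∧
      (∀ M, (∀ t ∈ I, l t ≤ M) → ∃ p ≤ M, (∀ t ∈ I, l t ≤ p) ∧ B.proj p ∉ U) ∧
      (∀ M, (∀ t ∈ I, M ≤ l t) → ∃ p, M ≤ p ∧ (∀ t ∈ I, p ≤ l t) ∧ B.proj p ∉ U) := by
  obtain ⟨l, hl, hlγ, hm, hs⟩ := h.1.exists_lift (Or.inl h.isOpen)
  have := h.1.2.1.nonempty.to_subtype
  have hm' : Monotone (fun t : I => l t) := fun s t hst => hm s.2 t.2 hst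
  refine ⟨l, hl, hlγ, hm, hs, fun M hM => ?_, fun M hM => ?_⟩
  · obtain ⟨p, hp, hpt⟩ := exists_isLUB_tendsto hm' (fun i => hM i i.2)
    refine ⟨p, hp.2 (by rintro - ⟨i, rfl⟩; exact hM i i.2), fun t ht => hp.1 ⟨⟨t, ht⟩, rfl⟩,
      fun hpU => h.2.2.1 ⟨_, hpU, ?_⟩⟩
    refine ((B.continuous_proj.tendsto p).comp hpt).congr fun t => hlγ t t.2
  · obtain ⟨p, hp, hpt⟩ := exists_isGLB_tendsto hm' (fun i => hM i i.2)
    refine ⟨p, hp.2 (by rintro - ⟨i, rfl⟩; exact hM i i.2), fun t ht => hp.1 ⟨⟨t, ht⟩, rfl⟩,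
      fun hpU => h.2.2.2 ⟨_, hpU, ?_⟩⟩
    refine ((B.continuous_proj.tendsto p).comp hpt).congr fun t => hlγ t t.2

/-- Along an inextensible causal curve of the full ambient spacetime, the time function takes
every value. -/
lemma IsInextensibleCausalCurve.exists_complete_lift (h : IsInextensibleCausalCurve univ γ I) :
    ∃ l : ℝ → ℝ × ℝ, (∀ t ∈ I, B.proj (l t) = γ t) ∧ MonotoneOn l I ∧
      StrictMonoOn (fun t => (l t).1 + (l t).2) I ∧
      ∀ τ, ∃ t ∈ I, (l t).1 + (l t).2 = τ := by
  obtain ⟨l, hl, hlγ, hm, hs, htop, hbot⟩ := h.exists_lift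
  refine ⟨l, hlγ, hm, hs, fun τ => ?_⟩
  obtain ⟨t₀, ht₀⟩ := h.1.2.1.nonempty
  have h1 : ∃ t ∈ I, τ ≤ (l t).1 + (l t).2 := by
    by_contra! hlt
    obtain ⟨p, -, -, hp⟩ := htop (max (l t₀).1 (τ - (l t₀).2), max (l t₀).2 (τ - (l t₀).1)) (by
      intro t ht
      rcases le_total t t₀ with htt | htt
      · exact ⟨(hm ht ht₀ htt).1.trans (le_max_left _ _), (hm ht ht₀ htt).2.trans (le_max_left _ _)⟩
      · have e1 := (hm ht₀ ht htt).1
        have e2 := (hm ht₀ ht htt).2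
        have e3 := hlt t ht
        exact ⟨le_max_of_le_right (by linarith), le_max_of_le_right (by linarith)⟩)
    exact hp trivial
  have h2 : ∃ t ∈ I, (l t).1 + (l t).2 ≤ τ := by
    by_contra! hlt
    obtain ⟨p, -, -, hp⟩ := hbot (min (l t₀).1 (τ - (l t₀).2), min (l t₀).2 (τ - (l t₀).1)) (by
      intro t ht
      rcases le_total t₀ t with htt | htt
      · exact ⟨(min_le_left _ _).trans (hm ht₀ ht htt).1, (min_le_left _ _).trans (hm ht₀ ht htt).2⟩
      · have e1 := (hm ht ht₀ htt).1
        have e2 := (hm ht ht₀ htt).2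
        have e3 := hlt t ht
        exact ⟨min_le_of_right_le (by linarith), min_le_of_right_le (by linarith)⟩)
    exact hp trivial
  obtain ⟨t₁, ht₁, e₁⟩ := h1
  obtain ⟨t₂, ht₂, e₂⟩ := h2
  have hc : ContinuousOn (fun t => (l t).1 + (l t).2) I :=
    (continuous_fst.comp_continuousOn hl).add (continuous_snd.comp_continuousOn hl)
  exact (h.1.1.isPreconnected.image _ hc).ordConnected.out ⟨t₂, ht₂, rfl⟩ ⟨t₁, ht₁, rfl⟩ ⟨e₂, e₁⟩

/-- An inextensible causal curve of the full ambient spacetime, parametrized by `τ = x⁺ + x⁻`. -/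
lemma IsInextensibleCausalCurve.exists_time_parametrization
    (h : IsInextensibleCausalCurve univ γ I) :
    ∃ c : ℝ → ℝ, Monotone c ∧ Monotone (fun τ => τ - c τ) ∧
      (∀ τ, ∃ t ∈ I, γ t = B.proj (c τ, τ - c τ)) ∧
      ∀ t ∈ I, ∃ τ, γ t = B.proj (c τ, τ - c τ) := by
  obtain ⟨l, hlγ, hm, hs, hτ⟩ := h.exists_complete_lift
  choose t htI ht using hτ
  have htm : Monotone t := fun τ σ hle => (hs.le_iff_le (htI τ) (htI σ)).1 (by simpa only [ht])
  have e : ∀ τ, τ - (l (t τ)).1 = (l (t τ)).2 := fun τ => by linarith [ht τ]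
  refine ⟨fun τ => (l (t τ)).1, fun τ σ hle => (hm (htI τ) (htI σ) (htm hle)).1, fun τ σ hle => ?_,
    fun τ => ⟨t τ, htI τ, ?_⟩, fun s hsI => ⟨(l s).1 + (l s).2, ?_⟩⟩
  · simp only [e]
    exact (hm (htI τ) (htI σ) (htm hle)).2
  · rw [e, ← hlγ _ (htI τ)]
  · have : t ((l s).1 + (l s).2) = s := hs.injOn (htI _) hsI (ht _)
    simp only [this, add_sub_cancel_left]
    exact (hlγ s hsI).symm

lemma continuous_of_monotone_of_monotone_sub {c : ℝ → ℝ} (h1 : Monotone c)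
    (h2 : Monotone (fun τ => τ - c τ)) : Continuous c := by
  refine (LipschitzWith.of_le_add (f := c) fun x y => ?_).continuous
  rw [Real.dist_eq]
  rcases le_total x y with h | h
  · have := h1 h
    have := abs_nonneg (x - y)
    linarith
  · have := h2 h
    have := le_abs_self (x - y)
    simp only at *
    linarith

/-- The surface of constant time is a Cauchy surface of the ambient spacetime. -/
lemma isCauchySurface_time (B : Background) (τ : ℝ) :
    IsCauchySurface (univ : Set B.Spacetime) {p | B.time p = τ} := by
  refine ⟨subset_univ _, fun γ I h => ?_⟩
  obtain ⟨l, hlγ, hm, hs, hτ⟩ := h.exists_complete_lift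
  obtain ⟨t, ht, e⟩ := hτ τ
  refine ⟨t, ⟨ht, ?_⟩, fun s ⟨hsI, hs'⟩ => hs.injOn hsI ht ?_⟩
  · rw [← hlγ t ht]
    exact e
  · rw [← hlγ s hsI] at hs'
    exact Eq.trans hs' e.symm

/-- A causal curve in the plane on which `x⁺ + x⁻` is the parameter up to a constant is
inextensible in the open set `U` if it is restricted to all of the parameters at which it lies
in `U`. -/
lemma isInextensibleCausalCurve_of_time (hU : IsOpen U) {l : ℝ → ℝ × ℝ} (hl : Continuous l) {c : ℝ}
    (hc : ∀ t, (l t).1 + (l t).2 = t + c) (hne : {t | B.proj (l t) ∈ U}.Nonempty)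
    (hcau : IsCausalCurve (fun t => B.proj (l t)) {t | B.proj (l t) ∈ U}) :
    IsInextensibleCausalCurve U (fun t => B.proj (l t)) {t | B.proj (l t) ∈ U} := by
  have hlc : Continuous (fun t => B.proj (l t)) := B.continuous_proj.comp hl
  have ho : IsOpen {t | B.proj (l t) ∈ U} := hU.preimage hlc
  set I := {t | B.proj (l t) ∈ U} with hI
  have hne' := hne.to_subtype
  have key : ∀ (F : Filter I) [F.NeBot] (p : B.Spacetime), p ∈ U →
      Tendsto (fun t : I => B.proj (l t)) F (𝓝 p) →
      ∃ e ∈ I, Tendsto (fun t : I => (t : ℝ)) F (𝓝 e) := by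
    intro F _ p hp hF
    have h1 : Tendsto (fun t : I => (t : ℝ)) F (𝓝 (B.time p - c)) := by
      refine (((B.continuous_time.tendsto p).comp hF).sub_const c).congr fun t => ?_
      simp only [Function.comp_apply, Background.time_proj, hc]
      ring
    have h2 := tendsto_nhds_unique hF ((hlc.tendsto _).comp h1)
    refine ⟨_, ?_, h1⟩
    rw [hI, mem_ofPred_eq, ← h2]
    exact hp
  refine ⟨hcau, fun t ht => ht, ?_, ?_⟩
  · rintro ⟨p, hp, hpt⟩
    obtain ⟨e, heI, he⟩ := key _ p hp hpt
    have hm : Monotone (fun t : I => (t : ℝ)) := fun _ _ h => h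
    obtain ⟨u, hu, hue⟩ := ((show ∀ᶠ u in 𝓝[>] e, u ∈ I from
      nhdsWithin_le_nhds (ho.mem_nhds heI)).and self_mem_nhdsWithin).exists
    exact absurd (hm.ge_of_tendsto he ⟨u, hu⟩) (not_le.2 hue)
  · rintro ⟨p, hp, hpt⟩
    obtain ⟨e, heI, he⟩ := key _ p hp hpt
    have hm : Monotone (fun t : I => (t : ℝ)) := fun _ _ h => h
    obtain ⟨u, hu, hue⟩ := ((show ∀ᶠ u in 𝓝[<] e, u ∈ I from
      nhdsWithin_le_nhds (ho.mem_nhds heI)).and self_mem_nhdsWithin).exists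
    exact absurd (hm.le_of_tendsto he ⟨u, hu⟩) (not_le.2 hue)

end Inextensible

/-! ### The objects of `C2` seen in the plane, and their Cauchy developments -/

lemma isPreconnected_of_slices {W : Set (ℝ × ℝ)} (ho : IsOpen W)
    (hs : ∀ c, _root_.IsPreconnected {t | (c, t) ∈ W})
    (hp : _root_.IsPreconnected (Prod.fst '' W)) :
    _root_.IsPreconnected W := by
  classical
  refine isPreconnected_of_forall_constant fun f hf x hx y hy => ?_
  have hslice : ∀ c s t, (c, s) ∈ W → (c, t) ∈ W → f (c, s) = f (c, t) := by
    intro c s t h1 h2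
    refine (hs c).constant (f := fun t => f (c, t)) ?_ h1 h2
    exact hf.comp (by fun_prop) fun t ht => ht
  have hex : ∀ c, ∃ t, c ∈ Prod.fst '' W → (c, t) ∈ W := by
    intro c
    by_cases hc : c ∈ Prod.fst '' W
    · obtain ⟨z, hz, rfl⟩ := hc
      exact ⟨z.2, fun _ => hz⟩
    · exact ⟨0, fun h => absurd h hc⟩
  choose t ht using hex
  have h := eq_of_eventually_eq hp (f := fun c => f (c, t c)) (fun c hc => ?_)
    (mem_image_of_mem _ hx) (mem_image_of_mem _ hy)
  · rw [show x = (x.1, x.2) from rfl, show y = (y.1, y.2) from rfl,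
      hslice _ _ (t x.1) hx (ht _ (mem_image_of_mem _ hx)),
      hslice _ _ (t y.1) hy (ht _ (mem_image_of_mem _ hy))]
    exact h
  · have h1 : ∀ᶠ z in 𝓝 (c, t c), z ∈ W ∧ f z = f (c, t c) := by
      refine (show ∀ᶠ z in 𝓝 (c, t c), z ∈ W from ho.mem_nhds (ht c hc)).and ?_
      have := (hf (c, t c) (ht c hc)).continuousAt (ho.mem_nhds (ht c hc))
      rw [ContinuousAt, nhds_discrete Bool, tendsto_pure] at this
      exact this
    have h2 : Tendsto (fun s => (s, t c)) (𝓝 c) (𝓝 (c, t c)) :=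
      Continuous.tendsto (by fun_prop) c
    filter_upwards [nhdsWithin_le_nhds (h2.eventually h1), self_mem_nhdsWithin] with s hs' hsW
    rw [hslice s (t s) (t c) (ht s hsW) hs'.1, hs'.2]

lemma isInextensibleCausalCurve_line_fst (B : Background) (c : ℝ) :
    IsInextensibleCausalCurve univ (fun t => B.proj (c, t)) univ := by
  have h := isInextensibleCausalCurve_of_time (B := B) isOpen_univ (l := fun t => (c, t)) (c := c)
    (by fun_prop) (fun t => add_comm _ _) ⟨0, trivial⟩
  simp only [mem_univ, ofPred_true] at h
  exact h (isCausalCurve_const_fst B c ordConnected_univ nontrivial_univ)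

lemma isInextensibleCausalCurve_line_snd (B : Background) (c : ℝ) :
    IsInextensibleCausalCurve univ (fun t => B.proj (t, c)) univ := by
  have h := isInextensibleCausalCurve_of_time (B := B) isOpen_univ (l := fun t => (t, c)) (c := c)
    (by fun_prop) (fun t => rfl) ⟨0, trivial⟩
  simp only [mem_univ, ofPred_true] at h
  exact h (isCausalCurve_const_snd B c ordConnected_univ nontrivial_univ)

namespace C2

variable (X : C2)

/-- The preimage in the plane of the set underlying an object. -/
def cover : Set (ℝ × ℝ) := X.background.proj ⁻¹' X.carrier

/-- The range of `x⁺` on (the preimage in the plane of) an object. -/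
def plus : Set ℝ := Prod.fst '' X.cover

/-- The range of `x⁻` on (the preimage in the plane of) an object. -/
def minus : Set ℝ := Prod.snd '' X.cover

variable {X}

lemma mem_cover {x : ℝ × ℝ} : x ∈ X.cover ↔ X.background.proj x ∈ X.carrier := Iff.rfl

lemma add_mem_cover {x d : ℝ × ℝ} (hd : d ∈ X.background.deck) :
    x + d ∈ X.cover ↔ x ∈ X.cover := by
  rw [mem_cover, mem_cover, Background.proj_add x hd]

lemma fst_mem_plus {x : ℝ × ℝ} (hx : x ∈ X.cover) : x.1 ∈ X.plus := ⟨x, hx, rfl⟩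

lemma snd_mem_minus {x : ℝ × ℝ} (hx : x ∈ X.cover) : x.2 ∈ X.minus := ⟨x, hx, rfl⟩

lemma exists_of_mem_plus {s : ℝ} (hs : s ∈ X.plus) : ∃ t, (s, t) ∈ X.cover := by
  obtain ⟨x, hx, rfl⟩ := hs
  exact ⟨x.2, hx⟩

lemma exists_of_mem_minus {t : ℝ} (ht : t ∈ X.minus) : ∃ s, (s, t) ∈ X.cover := by
  obtain ⟨x, hx, rfl⟩ := ht
  exact ⟨x.1, hx⟩

variable (X)

lemma isOpen_cover : IsOpen X.cover := X.isOpen.preimage X.background.continuous_proj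

lemma nonempty_cover : X.cover.Nonempty := by
  obtain ⟨p, hp⟩ := X.isConnected.nonempty
  obtain ⟨x, rfl⟩ := X.background.proj_surjective p
  exact ⟨x, hp⟩

lemma ordConnected_cover : X.cover.OrdConnected := ordConnected_preimage X.isOpen X.causallyConvex

lemma isOpen_plus : IsOpen X.plus := isOpenMap_fst _ X.isOpen_cover

lemma isOpen_minus : IsOpen X.minus := isOpenMap_snd _ X.isOpen_cover

lemma ordConnected_slice_fst (c : ℝ) : {t | (c, t) ∈ X.cover}.OrdConnected :=
  ⟨fun _ hs _ ht _ hu => X.ordConnected_cover.out hs ht ⟨⟨le_rfl, hu.1⟩, ⟨le_rfl, hu.2⟩⟩⟩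

lemma ordConnected_slice_snd (c : ℝ) : {t | (t, c) ∈ X.cover}.OrdConnected :=
  ⟨fun _ hs _ ht _ hu => X.ordConnected_cover.out hs ht ⟨⟨hu.1, le_rfl⟩, ⟨hu.2, le_rfl⟩⟩⟩

lemma isInextensibleCausalCurve_slice_fst {c : ℝ} (hc : c ∈ X.plus) :
    IsInextensibleCausalCurve X.carrier (fun t => X.background.proj (c, t))
      {t | (c, t) ∈ X.cover} := by
  obtain ⟨t, ht⟩ := exists_of_mem_plus hc
  refine isInextensibleCausalCurve_of_time X.isOpen (l := fun t => (c, t)) (c := c) (by fun_prop)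
    (fun t => add_comm _ _) ⟨t, ht⟩ (isCausalCurve_const_fst _ c (X.ordConnected_slice_fst c) ?_)
  exact (infinite_of_mem_nhds t ((X.isOpen_cover.preimage (by fun_prop)).mem_nhds ht)).nontrivial

lemma isInextensibleCausalCurve_slice_snd {c : ℝ} (hc : c ∈ X.minus) :
    IsInextensibleCausalCurve X.carrier (fun t => X.background.proj (t, c))
      {t | (t, c) ∈ X.cover} := by
  obtain ⟨t, ht⟩ := exists_of_mem_minus hc
  refine isInextensibleCausalCurve_of_time X.isOpen (l := fun t => (t, c)) (c := c) (by fun_prop)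
    (fun t => rfl) ⟨t, ht⟩ (isCausalCurve_const_snd _ c (X.ordConnected_slice_snd c) ?_)
  have hf : Continuous fun t : ℝ => (t, c) := by fun_prop
  exact (infinite_of_mem_nhds t ((X.isOpen_cover.preimage hf).mem_nhds ht)).nontrivial

lemma plus_eq_univ (hX : X.background = .cylinder) : X.plus = univ := by
  obtain ⟨S, hS, -, hS'⟩ := X.cauchy hX
  refine eq_univ_of_forall fun c => ?_
  obtain ⟨t, ⟨-, ht⟩, -⟩ := hS' _ _ (isInextensibleCausalCurve_line_fst X.background c)
  exact fst_mem_plus (X := X) (x := (c, t)) (hS ht)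

lemma minus_eq_univ (hX : X.background = .cylinder) : X.minus = univ := by
  obtain ⟨S, hS, -, hS'⟩ := X.cauchy hX
  refine eq_univ_of_forall fun c => ?_
  obtain ⟨t, ⟨-, ht⟩, -⟩ := hS' _ _ (isInextensibleCausalCurve_line_snd X.background c)
  exact snd_mem_minus (X := X) (x := (t, c)) (hS ht)

lemma isPreconnected_cover : _root_.IsPreconnected X.cover := by
  cases h : X.background with
  | minkowski =>
    exact X.isConnected.isPreconnected.preimage_of_isOpenMap (Background.proj_injective h)
      X.background.isOpenMap_proj
      (by rw [X.background.proj_surjective.range_eq]; exact subset_univ _)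
  | cylinder =>
    refine isPreconnected_of_slices X.isOpen_cover
      (fun c => (X.ordConnected_slice_fst c).isPreconnected) ?_
    rw [show Prod.fst '' X.cover = univ from X.plus_eq_univ h]
    exact isPreconnected_univ

lemma ordConnected_plus : X.plus.OrdConnected :=
  (X.isPreconnected_cover.image _ continuous_fst.continuousOn).ordConnected

lemma ordConnected_minus : X.minus.OrdConnected :=
  (X.isPreconnected_cover.image _ continuous_snd.continuousOn).ordConnected

lemma proj_mem_image_prod_iff {x : ℝ × ℝ} :
    X.background.proj x ∈ X.background.proj '' (X.plus ×ˢ X.minus) ↔ x ∈ X.plus ×ˢ X.minus := by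
  refine ⟨?_, fun h => mem_image_of_mem _ h⟩
  rintro ⟨y, ⟨h1, h2⟩, hyx⟩
  have hd := Background.proj_eq_iff.1 hyx
  obtain ⟨t, ht⟩ := exists_of_mem_plus h1
  obtain ⟨s, hs⟩ := exists_of_mem_minus h2
  have e1 := fst_mem_plus ((add_mem_cover hd).2 ht)
  have e2 := snd_mem_minus ((add_mem_cover hd).2 hs)
  simp at e1 e2
  exact ⟨e1, e2⟩

/-- The Cauchy development of an object is the image of the double cone spanned by it. A causal
curve through a point of this double cone that stayed outside of the object would separate the
points where the two null lines through the point meet the (connected) object. -/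
theorem cauchyDevelopment_carrier :
    cauchyDevelopment X.carrier = X.background.proj '' (X.plus ×ˢ X.minus) := by
  apply Subset.antisymm
  · intro p hp
    obtain ⟨x, rfl⟩ := X.background.proj_surjective p
    obtain ⟨t, -, ht⟩ := hp _ _ (isInextensibleCausalCurve_line_fst X.background x.1)
      ⟨x.2, trivial, rfl⟩
    obtain ⟨s, -, hs⟩ := hp _ _ (isInextensibleCausalCurve_line_snd X.background x.2)
      ⟨x.1, trivial, rfl⟩
    exact mem_image_of_mem _ ⟨fst_mem_plus (x := (x.1, t)) ht, snd_mem_minus (x := (s, x.2)) hs⟩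
  · rintro - ⟨x, hx, rfl⟩ γ I h ⟨t₀, ht₀, e₀⟩
    obtain ⟨c, hc, hc', hτ, hI⟩ := h.exists_time_parametrization
    obtain ⟨τ, eτ⟩ := hI t₀ ht₀
    have hp : (c τ, τ - c τ) ∈ X.plus ×ˢ X.minus := by
      rw [← X.proj_mem_image_prod_iff, ← eτ, e₀]
      exact mem_image_of_mem _ hx
    obtain ⟨q, hq⟩ := exists_of_mem_plus hp.1
    obtain ⟨r, hr⟩ := exists_of_mem_minus hp.2
    simp only at hq hr
    -- the curve is the zero set of `φ`
    let φ : ℝ × ℝ → ℝ := fun x => c (x.1 + x.2) - x.1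
    have hφ : Continuous φ :=
      ((continuous_of_monotone_of_monotone_sub hc hc').comp
        (continuous_fst.add continuous_snd)).sub continuous_fst
    have himg := (X.isPreconnected_cover.image φ hφ.continuousOn).ordConnected
    have hφq : φ (c τ, q) ∈ φ '' X.cover := mem_image_of_mem _ hq
    have hφr : φ (r, τ - c τ) ∈ φ '' X.cover := mem_image_of_mem _ hr
    suffices h0 : (0 : ℝ) ∈ φ '' X.cover by
      obtain ⟨z, hz, hz0⟩ := h0
      obtain ⟨t, ht, et⟩ := hτ (z.1 + z.2)
      refine ⟨t, ht, ?_⟩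
      have e : c (z.1 + z.2) = z.1 := sub_eq_zero.1 hz0
      rw [et, e, add_sub_cancel_left]
      exact hz
    have hφp : φ (c τ, τ - c τ) = 0 := by simp [φ]
    rcases le_total q (τ - c τ) with h1 | h1 <;> rcases le_total r (c τ) with h2 | h2
    · refine himg.out hφq hφr ⟨?_, ?_⟩
      · have := hc (show c τ + q ≤ τ by linarith)
        simp only [φ]
        linarith
      · have := hc' (show r + (τ - c τ) ≤ τ by linarith)
        simp only [φ] at this ⊢
        linarith
    · exact ⟨(c τ, τ - c τ), X.ordConnected_cover.out hq hr ⟨⟨le_rfl, h1⟩, ⟨h2, le_rfl⟩⟩, hφp⟩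
    · exact ⟨(c τ, τ - c τ), X.ordConnected_cover.out hr hq ⟨⟨h2, le_rfl⟩, ⟨le_rfl, h1⟩⟩, hφp⟩
    · refine himg.out hφr hφq ⟨?_, ?_⟩
      · have := hc' (show τ ≤ r + (τ - c τ) by linarith)
        simp only [φ] at this ⊢
        linarith
      · have := hc (show τ ≤ c τ + q by linarith)
        simp only [φ]
        linarith

end C2

/-! ### Conformal maps in light-cone coordinates -/

/-- An oriented and time-oriented conformal linear map is diagonal in light-cone coordinates, with
positive entries. -/
lemma IsOrientedConformal.diagonal {c : ℝ} {L : ℝ × ℝ →L[ℝ] ℝ × ℝ} (h : IsOrientedConformal c L) :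
    (L (1, 0)).2 = 0 ∧ (L (0, 1)).1 = 0 ∧ 0 < (L (1, 0)).1 ∧ 0 < (L (0, 1)).2 := by
  have h1 := h.conformal (1, 0) (1, 0)
  have h2 := h.conformal (0, 1) (0, 1)
  have h4 := h.orientation (0, 1) (1, 0) (by simp [areaForm])
  have h5 := h.timeOrientation (1, 0) (by simp [IsFutureCausal, metric, timeForm])
  have h6 := h.timeOrientation (0, 1) (by simp [IsFutureCausal, metric, timeForm])
  simp only [metric, areaForm, timeForm] at h1 h2 h4 h5 h6
  generalize (L (1, 0)).1 = a₁ at *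
  generalize (L (1, 0)).2 = a₂ at *
  generalize (L (0, 1)).1 = b₁ at *
  generalize (L (0, 1)).2 = b₂ at *
  have e1 : a₁ * a₂ = 0 := by linarith
  have e2 : b₁ * b₂ = 0 := by linarith
  have ha : a₁ ≠ 0 := by
    rintro rfl
    rcases mul_eq_zero.1 e2 with rfl | rfl
    · simp at h4
    · nlinarith
  have ha2 : a₂ = 0 := (mul_eq_zero.1 e1).resolve_left ha
  subst ha2
  have ha1 : 0 < a₁ := by linarith
  have hb : 0 < b₂ := by
    by_contra! hb
    nlinarith
  exact ⟨rfl, (mul_eq_zero.1 e2).resolve_right hb.ne', ha1, hb⟩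

lemma exists_primitive {P : Set ℝ} (ho : IsOpen P) (hP : P.OrdConnected) {A : ℝ → ℝ}
    (hA : ContinuousOn A P) : ∃ K : ℝ → ℝ, ∀ s ∈ P, HasDerivAt K (A s) s := by
  rcases P.eq_empty_or_nonempty with rfl | ⟨s₀, hs₀⟩
  · exact ⟨0, by simp⟩
  refine ⟨fun s => ∫ u in s₀..s, A u, fun s hs => ?_⟩
  exact intervalIntegral.integral_hasDerivAt_right
    (hA.mono (hP.uIcc_subset hs₀ hs)).intervalIntegrable
    (hA.stronglyMeasurableAtFilter ho s hs) (hA.continuousAt (ho.mem_nhds hs))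

lemma eventually_eq_add_const {K κ A : ℝ → ℝ} {s : ℝ} (h1 : ∀ᶠ u in 𝓝 s, HasDerivAt K (A u) u)
    (h2 : ∀ᶠ u in 𝓝 s, HasDerivAt κ (A u) u) : ∃ e, ∀ᶠ u in 𝓝 s, K u = κ u + e := by
  obtain ⟨δ, hδ, h⟩ := Metric.eventually_nhds_iff_ball.1 (h1.and h2)
  have hd : ∀ u ∈ Metric.ball s δ, HasDerivAt (K - κ) 0 u := fun u hu => by
    simpa using (h u hu).1.sub (h u hu).2
  obtain ⟨e, he⟩ := Metric.isOpen_ball.exists_is_const_of_deriv_eq_zero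
    (convex_ball s δ).isPreconnected (fun u hu => (hd u hu).differentiableAt.differentiableWithinAt)
    (fun u hu => (hd u hu).deriv)
  refine ⟨e, ?_⟩
  filter_upwards [Metric.ball_mem_nhds s hδ] with u hu
  have := he u hu
  simp only [Pi.sub_apply] at this
  linarith

/-- Functions `κ x` of the first coordinate, one near each point `x` of a plane set with connected
vertical slices, whose derivatives fit together, agree up to constants with a single function. -/
lemma exists_global_primitive {W : Set (ℝ × ℝ)} (ho : IsOpen W)
    (hs : ∀ c, _root_.IsPreconnected {t | (c, t) ∈ W}) (hP : (Prod.fst '' W).OrdConnected)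
    {κ : ℝ × ℝ → ℝ → ℝ} (hκ : ∀ x ∈ W, ContDiffAt ℝ ∞ (κ x) x.1)
    (hc : ∀ x ∈ W, ∀ᶠ y in 𝓝 x, deriv (κ y) y.1 = deriv (κ x) y.1) :
    ∃ K : ℝ → ℝ, ∀ x ∈ W, ∃ e, ∀ᶠ u in 𝓝 x.1, K u = κ x u + e := by
  have hex : ∀ c, ∃ t, c ∈ Prod.fst '' W → (c, t) ∈ W := by
    intro c
    by_cases hc : c ∈ Prod.fst '' W
    · obtain ⟨z, hz, rfl⟩ := hc
      exact ⟨z.2, fun _ => hz⟩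
    · exact ⟨0, fun h => absurd h hc⟩
  choose t ht using hex
  have hslice : ∀ x ∈ W, deriv (κ x) x.1 = deriv (κ (x.1, t x.1)) x.1 := by
    intro x hx
    refine eq_of_eventually_eq (hs x.1) (f := fun t => deriv (κ (x.1, t)) x.1) (fun r hr => ?_)
      (show (x.1, x.2) ∈ W from hx) (ht x.1 (mem_image_of_mem _ hx))
    have h2 : Tendsto (fun r => (x.1, r)) (𝓝 r) (𝓝 (x.1, r)) := Continuous.tendsto (by fun_prop) r
    exact nhdsWithin_le_nhds (h2.eventually (hc _ hr))
  let A : ℝ → ℝ := fun s => deriv (κ (s, t s)) s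
  have hA : ∀ x ∈ W, ∀ᶠ u in 𝓝 x.1, deriv (κ x) u = A u := by
    intro x hx
    have h2 : Tendsto (fun u => (u, x.2)) (𝓝 x.1) (𝓝 x) := Continuous.tendsto (by fun_prop) x.1
    filter_upwards [h2.eventually (hc x hx), h2.eventually (ho.mem_nhds hx)] with u hu huW
    rw [← hu, hslice _ huW]
  have hcont : ContinuousOn A (Prod.fst '' W) := by
    rintro - ⟨x, hx, rfl⟩
    have h1 : ContDiffAt ℝ 0 (fderiv ℝ (κ x)) x.1 := (hκ x hx).fderiv_right (by simp)
    have h2 : ContinuousAt (deriv (κ x)) x.1 := h1.continuousAt.clm_apply continuousAt_const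
    exact (h2.congr (hA x hx)).continuousWithinAt
  obtain ⟨K, hK⟩ := exists_primitive (isOpenMap_fst _ ho) hP hcont
  refine ⟨K, fun x hx => eventually_eq_add_const (A := A) ?_ ?_⟩
  · filter_upwards [(isOpenMap_fst _ ho).mem_nhds (mem_image_of_mem _ hx)] with u hu using hK u hu
  · have h1 : ∀ᶠ u in 𝓝 x.1, ContDiffAt ℝ 1 (κ x) u :=
      ((hκ x hx).of_le (by simp)).eventually (by simp)
    filter_upwards [h1, hA x hx] with u hu hAu
    rw [← hAu]
    exact (hu.differentiableAt (by simp)).hasDerivAt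

namespace C2

variable {X Y : C2}

open Classical in
/-- A map between objects, as a map from the plane to the ambient spacetime of the target; outside
of the preimage of the source it has a junk value. -/
def onCover (f : X.carrier → Y.carrier) (x : ℝ × ℝ) : Y.background.Spacetime :=
  if h : X.background.proj x ∈ X.carrier then f ⟨X.background.proj x, h⟩ else Y.background.proj 0

lemma onCover_of_mem (f : X.carrier → Y.carrier) {x : ℝ × ℝ} (hx : x ∈ X.cover) :
    onCover f x = f ⟨X.background.proj x, hx⟩ := dif_pos hx

/-- Near each point, a conformal map lifts to a product of two functions of the light-cone
coordinates. -/
lemma IsConformalMap.exists_local_product {f : X.carrier → Y.carrier} (hf : IsConformalMap f)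
    {x : ℝ × ℝ} (hx : x ∈ X.cover) : ∃ k₁ k₂ : ℝ → ℝ,
      (∀ᶠ y in 𝓝 x, onCover f y = Y.background.proj (k₁ y.1, k₂ y.2)) ∧
      (ContDiffAt ℝ ∞ k₁ x.1 ∧ 0 < deriv k₁ x.1) ∧ ContDiffAt ℝ ∞ k₂ x.2 ∧ 0 < deriv k₂ x.2 := by
  obtain ⟨c, -, -, H⟩ := hf
  have hlift : ∀ x ∈ X.cover, ∃ F : ℝ × ℝ → ℝ × ℝ,
      (∀ᶠ y in 𝓝 x, Y.background.proj (F y) = onCover f y) ∧ ContDiffAt ℝ ∞ F x ∧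
      IsOrientedConformal (c (X.background.proj x)) (fderiv ℝ F x) := by
    intro x hx
    obtain ⟨F, h1, h2, h3⟩ := H x hx
    refine ⟨F, ?_, h2, h3⟩
    filter_upwards [h1, X.isOpen_cover.mem_nhds hx] with y hy hyX
    rw [hy hyX, onCover_of_mem f hyX]
  obtain ⟨F, hF, hFs, hFc⟩ := hlift x hx
  -- the differential of `F` is diagonal near `x`, since there `F` differs by a constant from the
  -- lift belonging to each nearby point
  have hd : ∀ᶠ y in 𝓝 x, ∃ L : ℝ × ℝ →L[ℝ] ℝ × ℝ, HasFDerivAt F L y ∧ (L (1, 0)).2 = 0 ∧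
      (L (0, 1)).1 = 0 ∧ 0 < (L (1, 0)).1 ∧ 0 < (L (0, 1)).2 := by
    have h1 : ∀ᶠ u in 𝓝 x, ContDiffAt ℝ 1 F u := (hFs.of_le (by simp)).eventually (by simp)
    filter_upwards [h1, X.isOpen_cover.mem_nhds hx, hF.eventually_nhds] with y hy hyX hFy
    obtain ⟨G, hG, hGs, hGc⟩ := hlift y hyX
    refine ⟨fderiv ℝ G y, ?_, IsOrientedConformal.diagonal hGc⟩
    have h2 := Background.eventually_sub_eq (s := univ) (B := Y.background) (mem_univ y)
      hy.continuousAt.continuousWithinAt hGs.continuousAt.continuousWithinAt (by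
        rw [nhdsWithin_univ]
        filter_upwards [hFy, hG] with z h1 h2
        rw [h1, h2])
    rw [nhdsWithin_univ] at h2
    have hGd := (hGs.differentiableAt (by simp)).hasFDerivAt.add_const (F y - G y)
    refine hGd.congr_of_eventuallyEq ?_
    filter_upwards [h2] with z hz
    rw [← hz]
    abel
  obtain ⟨δ, hδ, hball⟩ := Metric.eventually_nhds_iff_ball.1 hd
  have hbox : ∀ s t, s ∈ Metric.ball x.1 δ → t ∈ Metric.ball x.2 δ → (s, t) ∈ Metric.ball x δ := by
    intro s t hs ht
    rw [show x = (x.1, x.2) from rfl, ← ball_prod_same]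
    exact ⟨hs, ht⟩
  have hder₁ : ∀ s t, s ∈ Metric.ball x.1 δ → t ∈ Metric.ball x.2 δ →
      HasDerivAt (fun u => (F (u, t)).2) 0 s ∧
        ∃ a, 0 < a ∧ HasDerivAt (fun u => (F (u, t)).1) a s := by
    intro s t hs ht
    obtain ⟨L, hL, h1, h2, h3, h4⟩ := hball _ (hbox s t hs ht)
    have h5 : HasDerivAt (fun u => F (u, t)) (L (1, 0)) s :=
      hL.comp_hasDerivAt s ((hasDerivAt_id s).prodMk (hasDerivAt_const s t))
    exact ⟨h1 ▸ hasDerivAt_snd_of h5, _, h3, hasDerivAt_fst_of h5⟩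
  have hder₂ : ∀ s t, s ∈ Metric.ball x.1 δ → t ∈ Metric.ball x.2 δ →
      HasDerivAt (fun u => (F (s, u)).1) 0 t ∧
        ∃ a, 0 < a ∧ HasDerivAt (fun u => (F (s, u)).2) a t := by
    intro s t hs ht
    obtain ⟨L, hL, h1, h2, h3, h4⟩ := hball _ (hbox s t hs ht)
    have h5 : HasDerivAt (fun u => F (s, u)) (L (0, 1)) t :=
      hL.comp_hasDerivAt t ((hasDerivAt_const t s).prodMk (hasDerivAt_id t))
    exact ⟨h2 ▸ hasDerivAt_fst_of h5, _, h4, hasDerivAt_snd_of h5⟩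
  have hx₁ := Metric.mem_ball_self (x := x.1) hδ
  have hx₂ := Metric.mem_ball_self (x := x.2) hδ
  refine ⟨fun s => (F (s, x.2)).1, fun t => (F (x.1, t)).2, ?_, ⟨?_, ?_⟩, ?_, ?_⟩
  · filter_upwards [hF, Metric.ball_mem_nhds x hδ] with y hy hyb
    rw [← hy]
    congr 1
    rw [show x = (x.1, x.2) from rfl, ← ball_prod_same] at hyb
    obtain ⟨hy1, hy2⟩ := hyb
    refine Prod.ext ?_ ?_
    · exact Metric.isOpen_ball.is_const_of_deriv_eq_zero (convex_ball x.2 δ).isPreconnected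
        (f := fun u => (F (y.1, u)).1)
        (fun u hu => (hder₂ y.1 u hy1 hu).1.differentiableAt.differentiableWithinAt)
        (fun u hu => (hder₂ y.1 u hy1 hu).1.deriv) hy2 hx₂
    · exact Metric.isOpen_ball.is_const_of_deriv_eq_zero (convex_ball x.1 δ).isPreconnected
        (f := fun u => (F (u, y.2)).2)
        (fun u hu => (hder₁ u y.2 hu hy2).1.differentiableAt.differentiableWithinAt)
        (fun u hu => (hder₁ u y.2 hu hy2).1.deriv) hy1 hx₁
  · exact contDiff_fst.contDiffAt.comp x.1
      (ContDiffAt.comp x.1 (g := F) (f := fun s => (s, x.2)) hFs (by fun_prop))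
  · obtain ⟨a, ha, h⟩ := (hder₁ x.1 x.2 hx₁ hx₂).2
    rw [h.deriv]
    exact ha
  · exact contDiff_snd.contDiffAt.comp x.2
      (ContDiffAt.comp x.2 (g := F) (f := fun t => (x.1, t)) hFs (by fun_prop))
  · obtain ⟨a, ha, h⟩ := (hder₂ x.1 x.2 hx₁ hx₂).2
    rw [h.deriv]
    exact ha

end C2

/-! ### Global light-cone form of conformal maps -/

/-- The function `k` is smooth with positive derivative at the points of `P`. -/
def IsSmoothIncreasing (k : ℝ → ℝ) (P : Set ℝ) : Prop :=
  ∀ s ∈ P, ContDiffAt ℝ ∞ k s ∧ 0 < deriv k s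

namespace IsSmoothIncreasing

variable {k : ℝ → ℝ} {P : Set ℝ}

lemma hasStrictDerivAt (h : IsSmoothIncreasing k P) {s : ℝ} (hs : s ∈ P) :
    HasStrictDerivAt k (deriv k s) s :=
  (h s hs).1.hasStrictDerivAt (by simp)

lemma continuousOn (h : IsSmoothIncreasing k P) : ContinuousOn k P := fun s hs =>
  (h s hs).1.continuousAt.continuousWithinAt

lemma strictMonoOn (h : IsSmoothIncreasing k P) (hP : P.OrdConnected) : StrictMonoOn k P :=
  strictMonoOn_of_deriv_pos hP.convex h.continuousOn fun s hs => (h s (interior_subset hs)).2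

lemma map_nhds_eq (h : IsSmoothIncreasing k P) {s : ℝ} (hs : s ∈ P) : map k (𝓝 s) = 𝓝 (k s) :=
  (h.hasStrictDerivAt hs).map_nhds_eq (h s hs).2.ne'

lemma ordConnected_image (h : IsSmoothIncreasing k P) (hP : P.OrdConnected) :
    (k '' P).OrdConnected :=
  (hP.isPreconnected.image k h.continuousOn).ordConnected

lemma isOpen_image (h : IsSmoothIncreasing k P) (hP : IsOpen P) : IsOpen (k '' P) := by
  rw [isOpen_iff_mem_nhds]
  rintro - ⟨s, hs, rfl⟩
  rw [← h.map_nhds_eq hs]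
  exact image_mem_map (hP.mem_nhds hs)

lemma congr_add_const {κ : ℝ → ℝ} {s e : ℝ} (h : IsSmoothIncreasing κ {s})
    (hk : ∀ᶠ u in 𝓝 s, k u = κ u + e) : IsSmoothIncreasing k {s} := by
  intro u hu
  rw [mem_singleton_iff.1 hu]
  have hk' : k =ᶠ[𝓝 s] fun u => κ u + e := hk
  refine ⟨((h s rfl).1.add contDiffAt_const).congr_of_eventuallyEq hk', ?_⟩
  rw [hk'.deriv_eq, deriv_add_const]
  exact (h s rfl).2

end IsSmoothIncreasing

namespace C2

variable {X Y : C2}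

/-- The map `(k₁, k₂)`, given by one function for each light-cone coordinate, is a lift to the
plane of the map `f` between objects. -/
structure IsLift (f : X.carrier → Y.carrier) (k₁ k₂ : ℝ → ℝ) : Prop where
  smooth_plus : IsSmoothIncreasing k₁ X.plus
  smooth_minus : IsSmoothIncreasing k₂ X.minus
  onCover_eq : ∀ x ∈ X.cover, onCover f x = Y.background.proj (k₁ x.1, k₂ x.2)

/-- Every conformal map lifts to a product of functions of the two light-cone coordinates. The local
lifts have derivatives that do not depend on any choice, and the factors are obtained from these
derivatives by integration. -/
theorem IsConformalMap.exists_isLift {f : X.carrier → Y.carrier} (hf : IsConformalMap f) :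
    ∃ k₁ k₂, IsLift f k₁ k₂ := by
  choose! κ₁ κ₂ hκ h₁ h₂ using fun x (hx : x ∈ X.cover) => hf.exists_local_product hx
  have hcompat : ∀ x ∈ X.cover, ∀ᶠ y in 𝓝 x, deriv (κ₁ y) y.1 = deriv (κ₁ x) y.1 ∧
      deriv (κ₂ y) y.2 = deriv (κ₂ x) y.2 := by
    intro x hx
    have c₁ : ∀ᶠ y in 𝓝 x, ContDiffAt ℝ 1 (κ₁ x) y.1 := continuousAt_fst.eventually
      (((h₁ x hx).1.of_le (by simp)).eventually (by simp))
    have c₂ : ∀ᶠ y in 𝓝 x, ContDiffAt ℝ 1 (κ₂ x) y.2 := continuousAt_snd.eventually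
      (((h₂ x hx).1.of_le (by simp)).eventually (by simp))
    filter_upwards [c₁, c₂, (hκ x hx).eventually_nhds, X.isOpen_cover.mem_nhds hx]
      with y hy₁ hy₂ hy hyX
    have hF : ∀ z ∈ X.cover, ContinuousAt (κ₁ z) y.1 → ContinuousAt (κ₂ z) y.2 →
        ContinuousWithinAt (fun u : ℝ × ℝ => (κ₁ z u.1, κ₂ z u.2)) univ y := fun z _ hz₁ hz₂ =>
      ((ContinuousAt.comp (g := κ₁ z) hz₁ continuousAt_fst).prodMk
        (ContinuousAt.comp (g := κ₂ z) hz₂ continuousAt_snd)).continuousWithinAt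
    have h3 := Background.eventually_sub_eq (B := Y.background) (mem_univ y)
      (hF y hyX (h₁ y hyX).1.continuousAt (h₂ y hyX).1.continuousAt)
      (hF x hx hy₁.continuousAt hy₂.continuousAt) (by
        rw [nhdsWithin_univ]
        filter_upwards [hy, hκ y hyX] with z e1 e2
        rw [← e1, ← e2])
    rw [nhdsWithin_univ] at h3
    have t₁ : Tendsto (fun u => (u, y.2)) (𝓝 y.1) (𝓝 y) := Continuous.tendsto (by fun_prop) y.1
    have t₂ : Tendsto (fun u => (y.1, u)) (𝓝 y.2) (𝓝 y) := Continuous.tendsto (by fun_prop) y.2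
    constructor
    · have e : κ₁ y =ᶠ[𝓝 y.1] fun u => κ₁ x u + (κ₁ y y.1 - κ₁ x y.1) := by
        filter_upwards [t₁.eventually h3] with u hu
        have := congrArg Prod.fst hu
        simp only [Prod.mk_sub_mk] at this
        linarith
      rw [e.deriv_eq, deriv_add_const]
    · have e : κ₂ y =ᶠ[𝓝 y.2] fun u => κ₂ x u + (κ₂ y y.2 - κ₂ x y.2) := by
        filter_upwards [t₂.eventually h3] with u hu
        have := congrArg Prod.snd hu
        simp only [Prod.mk_sub_mk] at this
        linarith
      rw [e.deriv_eq, deriv_add_const]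
  obtain ⟨K₁, hK₁⟩ := exists_global_primitive X.isOpen_cover
    (fun c => (X.ordConnected_slice_fst c).isPreconnected) X.ordConnected_plus (κ := κ₁)
    (fun x hx => (h₁ x hx).1) (fun x hx => (hcompat x hx).mono fun y hy => hy.1)
  obtain ⟨K₂, hK₂⟩ := exists_global_primitive (W := Prod.swap ⁻¹' X.cover)
    (X.isOpen_cover.preimage continuous_swap)
    (fun c => (X.ordConnected_slice_snd c).isPreconnected)
    (by
      convert X.ordConnected_minus using 1
      ext t
      constructor
      · rintro ⟨x, hx, rfl⟩
        exact ⟨_, hx, rfl⟩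
      · rintro ⟨x, hx, rfl⟩
        exact ⟨x.swap, by simpa using hx, rfl⟩) (κ := fun x => κ₂ x.swap)
    (fun x hx => (h₂ _ hx).1)
    (fun x hx => (continuous_swap.continuousAt.eventually (hcompat _ hx)).mono fun y hy => hy.2)
  obtain ⟨c, hc⟩ := Background.exists_const_of_locally (B := Y.background) X.isPreconnected_cover
    (g := onCover f) (h := fun x => (K₁ x.1, K₂ x.2)) (by
      intro x hx
      obtain ⟨e₁, he₁⟩ := hK₁ x hx
      obtain ⟨e₂, he₂⟩ := hK₂ x.swap (by simpa using hx)
      refine ⟨(-e₁, -e₂), nhdsWithin_le_nhds ?_⟩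
      filter_upwards [hκ x hx, continuousAt_fst.eventually he₁, continuousAt_snd.eventually he₂]
        with y hy hy₁ hy₂
      rw [hy, hy₁, hy₂]
      simp)
  refine ⟨fun s => K₁ s + c.1, fun t => K₂ t + c.2, ?_, ?_, hc⟩
  · rintro - ⟨x, hx, rfl⟩
    obtain ⟨e₁, he₁⟩ := hK₁ x hx
    refine IsSmoothIncreasing.congr_add_const (κ := κ₁ x) (e := e₁ + c.1) (fun s hs => ?_)
      (he₁.mono fun u hu => by rw [hu, add_assoc]) _ rfl
    rw [mem_singleton_iff.1 hs]
    exact h₁ x hx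
  · rintro - ⟨x, hx, rfl⟩
    obtain ⟨e₂, he₂⟩ := hK₂ x.swap (by simpa using hx)
    refine IsSmoothIncreasing.congr_add_const (κ := κ₂ x) (e := e₂ + c.2) (fun s hs => ?_)
      (he₂.mono fun u hu => by rw [hu, add_assoc]; rfl) _ rfl
    rw [mem_singleton_iff.1 hs]
    exact h₂ x hx

end C2

/-! ### Deck translations and maps given in light-cone coordinates -/

lemma IsSmoothIncreasing.of_leftInverse {k l : ℝ → ℝ} {P : Set ℝ} (h : IsSmoothIncreasing k P)
    (hP : IsOpen P) (hl : ∀ s ∈ P, l (k s) = s) : IsSmoothIncreasing l (k '' P) := by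
  rintro - ⟨s, hs, rfl⟩
  have hpos := (h s hs).2
  let e : ℝ ≃L[ℝ] ℝ := ContinuousLinearEquiv.unitsEquivAut ℝ (Units.mk0 (deriv k s) hpos.ne')
  have hd : HasFDerivAt k (e : ℝ →L[ℝ] ℝ) s := (h.hasStrictDerivAt hs).hasDerivAt.hasFDerivAt
  have hn : (∞ : WithTop ℕ∞) ≠ 0 := by simp
  have hinv := (h s hs).1.to_localInverse hd hn
  have hinvx : (h s hs).1.localInverse hd hn (k s) = s := (h s hs).1.localInverse_apply_image hd hn
  have hright : ∀ᶠ z in 𝓝 (k s), k ((h s hs).1.localInverse hd hn z) = z :=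
    ((h s hs).1.hasStrictFDerivAt' hd hn).eventually_right_inverse
  generalize (h s hs).1.localInverse hd hn = m at hinv hinvx hright
  have hm : ∀ᶠ z in 𝓝 (k s), m z ∈ P := by
    have := hinv.continuousAt.tendsto
    rw [hinvx] at this
    exact this.eventually (hP.mem_nhds hs)
  have hlm : l =ᶠ[𝓝 (k s)] m := by
    filter_upwards [hright, hm] with z hz hzP
    rw [← hl _ hzP, hz]
  have hls : ContDiffAt ℝ ∞ l (k s) := hinv.congr_of_eventuallyEq hlm
  refine ⟨hls, ?_⟩
  have h1 : HasDerivAt (fun u => l (k u)) (deriv l (k s) * deriv k s) s :=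
    (hls.differentiableAt (by simp)).hasDerivAt.comp s (h.hasStrictDerivAt hs).hasDerivAt
  have h2 : HasDerivAt (fun u => l (k u)) 1 s := (hasDerivAt_id s).congr_of_eventuallyEq (by
    filter_upwards [hP.mem_nhds hs] with u hu using hl u hu)
  exact pos_of_mul_pos_left (by rw [h1.unique h2]; exact one_pos) hpos.le

/-- A preconnected set that is covered by open sets, each of which is contained in or disjoint
from the open set `A`, lies in `A` as soon as it meets `A`. -/
lemma subset_of_subset_iUnion_of_inter_nonempty {E ι : Type*} [TopologicalSpace E] {P A : Set E}
    {T : ι → Set E} (hP : _root_.IsPreconnected P) (hA : IsOpen A) (hT : ∀ i, IsOpen (T i))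
    (hTA : ∀ i, (T i ∩ A).Nonempty → T i ⊆ A) (hPT : P ⊆ ⋃ i, T i) (hPA : (P ∩ A).Nonempty) :
    P ⊆ A := by
  refine hP.subset_left_of_subset_union (v := ⋃ i : {i // Disjoint A (T i)}, T i) hA
    (isOpen_iUnion fun i => hT i) (disjoint_iUnion_right.2 fun i => i.2) (fun x hx => ?_) hPA
  obtain ⟨i, hi⟩ := mem_iUnion.1 (hPT hx)
  by_cases hd : Disjoint A (T i)
  · exact Or.inr (mem_iUnion.2 ⟨⟨i, hd⟩, hi⟩)
  · rw [disjoint_comm, not_disjoint_iff_nonempty_inter] at hd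
    exact Or.inl (hTA i hd hi)

namespace C2

variable {X Y : C2}

lemma add_mem_plus {d : ℝ × ℝ} (hd : d ∈ X.background.deck) {s : ℝ} (hs : s ∈ X.plus) :
    s + d.1 ∈ X.plus := by
  obtain ⟨t, ht⟩ := exists_of_mem_plus hs
  exact fst_mem_plus ((add_mem_cover hd).2 ht)

lemma add_mem_minus {d : ℝ × ℝ} (hd : d ∈ X.background.deck) {s : ℝ} (hs : s ∈ X.minus) :
    s + d.2 ∈ X.minus := by
  obtain ⟨t, ht⟩ := exists_of_mem_minus hs
  exact snd_mem_minus ((add_mem_cover hd).2 ht)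

/-- Two lifts to the plane that agree after projection differ by a single deck translation, even
on the whole double cone spanned by the source. -/
lemma exists_deck_of_proj_eq {B : Background} {k₁ k₂ l₁ l₂ : ℝ → ℝ} (hk₁ : ContinuousOn k₁ X.plus)
    (hk₂ : ContinuousOn k₂ X.minus) (hl₁ : ContinuousOn l₁ X.plus) (hl₂ : ContinuousOn l₂ X.minus)
    (h : ∀ x ∈ X.cover, B.proj (k₁ x.1, k₂ x.2) = B.proj (l₁ x.1, l₂ x.2)) :
    ∃ d ∈ B.deck, (∀ s ∈ X.plus, k₁ s = l₁ s + d.1) ∧ ∀ t ∈ X.minus, k₂ t = l₂ t + d.2 := by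
  obtain ⟨x₀, hx₀⟩ := X.nonempty_cover
  have hk : ContinuousOn (fun x : ℝ × ℝ => (k₁ x.1, k₂ x.2)) X.cover :=
    (hk₁.comp continuousOn_fst fun x hx => fst_mem_plus hx).prodMk
      (hk₂.comp continuousOn_snd fun x hx => snd_mem_minus hx)
  have hl : ContinuousOn (fun x : ℝ × ℝ => (l₁ x.1, l₂ x.2)) X.cover :=
    (hl₁.comp continuousOn_fst fun x hx => fst_mem_plus hx).prodMk
      (hl₂.comp continuousOn_snd fun x hx => snd_mem_minus hx)
  have hconst : ∀ x ∈ X.cover, (k₁ x.1, k₂ x.2) - (l₁ x.1, l₂ x.2) =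
      (k₁ x₀.1, k₂ x₀.2) - (l₁ x₀.1, l₂ x₀.2) := fun x hx =>
    eq_of_eventually_eq X.isPreconnected_cover
      (f := fun x : ℝ × ℝ => (k₁ x.1, k₂ x.2) - (l₁ x.1, l₂ x.2))
      (fun y hy => Background.eventually_sub_eq (B := B) hy (hk y hy) (hl y hy)
        (eventually_mem_nhdsWithin.mono fun z hz => h z hz)) hx hx₀
  refine ⟨_, Background.proj_eq_iff.1 (h x₀ hx₀).symm, fun s hs => ?_, fun t ht => ?_⟩
  · obtain ⟨t, ht⟩ := exists_of_mem_plus hs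
    have := congrArg Prod.fst (hconst _ ht)
    simp only [Prod.mk_sub_mk] at this ⊢
    linarith
  · obtain ⟨s, hs⟩ := exists_of_mem_minus ht
    have := congrArg Prod.snd (hconst _ hs)
    simp only [Prod.mk_sub_mk] at this ⊢
    linarith

namespace IsLift

variable {f : X.carrier → Y.carrier} {k₁ k₂ : ℝ → ℝ}

lemma proj_mem (h : IsLift f k₁ k₂) {x : ℝ × ℝ} (hx : x ∈ X.cover) :
    (k₁ x.1, k₂ x.2) ∈ Y.cover := by
  rw [mem_cover, ← h.onCover_eq x hx, onCover_of_mem f hx]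
  exact (f _).2

lemma mem_plus (h : IsLift f k₁ k₂) {s : ℝ} (hs : s ∈ X.plus) : k₁ s ∈ Y.plus := by
  obtain ⟨t, ht⟩ := exists_of_mem_plus hs
  exact fst_mem_plus (h.proj_mem ht)

lemma mem_minus (h : IsLift f k₁ k₂) {s : ℝ} (hs : s ∈ X.minus) : k₂ s ∈ Y.minus := by
  obtain ⟨t, ht⟩ := exists_of_mem_minus hs
  exact snd_mem_minus (h.proj_mem ht)

/-- A lift intertwines deck translations. -/
lemma exists_deck (h : IsLift f k₁ k₂) {d : ℝ × ℝ} (hd : d ∈ X.background.deck) :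
    ∃ d' ∈ Y.background.deck, (∀ s ∈ X.plus, k₁ (s + d.1) = k₁ s + d'.1) ∧
      ∀ t ∈ X.minus, k₂ (t + d.2) = k₂ t + d'.2 := by
  refine exists_deck_of_proj_eq (B := Y.background)
    (k₁ := fun s => k₁ (s + d.1)) (k₂ := fun t => k₂ (t + d.2))
    (h.smooth_plus.continuousOn.comp (by fun_prop) fun s hs => add_mem_plus hd hs)
    (h.smooth_minus.continuousOn.comp (by fun_prop) fun s hs => add_mem_minus hd hs)
    h.smooth_plus.continuousOn h.smooth_minus.continuousOn fun x hx => ?_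
  have hxd := (add_mem_cover hd).2 hx
  have h1 := h.onCover_eq _ hxd
  have h2 := h.onCover_eq _ hx
  rw [← h2]
  refine h1.symm.trans ?_
  rw [onCover_of_mem f hx, onCover_of_mem f hxd]
  congr 2
  exact Subtype.ext (Background.proj_add x hd)

lemma map_nhds_eq (h : IsLift f k₁ k₂) {x : ℝ × ℝ} (hx : x ∈ X.plus ×ˢ X.minus) :
    Filter.map (fun x : ℝ × ℝ => (k₁ x.1, k₂ x.2)) (𝓝 x) = 𝓝 (k₁ x.1, k₂ x.2) := by
  rw [nhds_prod_eq, nhds_prod_eq, ← h.smooth_plus.map_nhds_eq hx.1,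
    ← h.smooth_minus.map_nhds_eq hx.2, Filter.prod_map_map_eq]

lemma isOpen_image (h : IsLift f k₁ k₂) {O : Set (ℝ × ℝ)} (hO : IsOpen O) (hOX : O ⊆ X.cover) :
    IsOpen ((fun x : ℝ × ℝ => (k₁ x.1, k₂ x.2)) '' O) := by
  rw [isOpen_iff_mem_nhds]
  rintro - ⟨x, hx, rfl⟩
  rw [← h.map_nhds_eq ⟨fst_mem_plus (hOX hx), snd_mem_minus (hOX hx)⟩]
  exact image_mem_map (hO.mem_nhds hx)

lemma apply_proj (h : IsLift f k₁ k₂) {x : ℝ × ℝ} (hx : x ∈ X.cover) :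
    (f ⟨X.background.proj x, hx⟩ : Y.background.Spacetime) =
      Y.background.proj (k₁ x.1, k₂ x.2) := by
  rw [← h.onCover_eq x hx, onCover_of_mem f hx]

lemma continuousOn_lift (h : IsLift f k₁ k₂) :
    ContinuousOn (fun x : ℝ × ℝ => (k₁ x.1, k₂ x.2)) X.cover :=
  (h.smooth_plus.continuousOn.comp continuousOn_fst fun _ hx => fst_mem_plus hx).prodMk
    (h.smooth_minus.continuousOn.comp continuousOn_snd fun _ hx => snd_mem_minus hx)

/-- The preimage in the plane of the image of `f` is the union of the deck translates of the image
of the lift. -/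
lemma mem_image_iff (h : IsLift f k₁ k₂) {y : ℝ × ℝ} : Y.background.proj y ∈ image f ↔
    ∃ x ∈ X.cover, ∃ d ∈ Y.background.deck, y = (k₁ x.1, k₂ x.2) + d := by
  constructor
  · rintro ⟨-, ⟨⟨p, hp⟩, rfl⟩, hpy⟩
    obtain ⟨x, rfl⟩ := X.background.proj_surjective p
    rw [h.apply_proj hp] at hpy
    exact ⟨x, hp, _, Background.proj_eq_iff.1 hpy, by abel⟩
  · rintro ⟨x, hx, d, hd, rfl⟩
    rw [Background.proj_add _ hd, ← h.apply_proj hx]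
    exact mem_image_of_mem _ (mem_range_self _)

lemma isOpen_image_map (h : IsLift f k₁ k₂) {O : Set X.carrier} (hO : IsOpen O) :
    IsOpen (f '' O) := by
  obtain ⟨V, hV, rfl⟩ := hO
  have h1 : IsOpen (X.cover ∩ X.background.proj ⁻¹' V) :=
    X.isOpen_cover.inter (hV.preimage X.background.continuous_proj)
  have h2 := (Y.background.isOpenMap_proj _ (h.isOpen_image h1 inter_subset_left)).preimage
    (continuous_subtype_val (p := (· ∈ Y.carrier)))
  convert h2 using 1
  ext q
  constructor
  · rintro ⟨⟨p, hp⟩, hpV, rfl⟩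
    obtain ⟨x, rfl⟩ := X.background.proj_surjective p
    exact ⟨_, ⟨x, ⟨hp, hpV⟩, rfl⟩, (h.apply_proj hp).symm⟩
  · rintro ⟨-, ⟨x, ⟨hx, hxV⟩, rfl⟩, hxq⟩
    exact ⟨⟨_, hx⟩, hxV, Subtype.ext ((h.apply_proj hx).trans hxq)⟩

lemma isOpen_image_carrier (h : IsLift f k₁ k₂) : IsOpen (image f) := by
  have := Y.isOpen.isOpenMap_subtype_val _ (h.isOpen_image_map isOpen_univ)
  rwa [image_univ] at this

lemma continuous (h : IsLift f k₁ k₂) : Continuous f := by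
  refine continuous_induced_rng.2 (continuous_def.2 fun V hV => ?_)
  rw [X.isOpen.isOpenEmbedding_subtypeVal.isOpen_iff_image_isOpen]
  have h1 := X.background.isOpenMap_proj _ (h.continuousOn_lift.isOpen_inter_preimage X.isOpen_cover
    (hV.preimage Y.background.continuous_proj))
  convert h1 using 1
  ext p
  constructor
  · rintro ⟨⟨p, hp⟩, hpV, rfl⟩
    obtain ⟨x, rfl⟩ := X.background.proj_surjective p
    refine ⟨x, ⟨hp, ?_⟩, rfl⟩
    rwa [mem_preimage, mem_preimage, ← h.apply_proj hp]
  · rintro ⟨x, ⟨hx, hxV⟩, rfl⟩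
    refine ⟨⟨_, hx⟩, ?_, rfl⟩
    rwa [mem_preimage, Function.comp_apply, h.apply_proj hx]

lemma isEmbedding (h : IsLift f k₁ k₂) (hf : Function.Injective f) : IsEmbedding f :=
  (IsOpenEmbedding.of_continuous_injective_isOpenMap h.continuous hf
    fun _ hO => h.isOpen_image_map hO).isEmbedding

/-- A map that is smooth and increasing in each light-cone coordinate is conformal. -/
lemma isConformalMap (h : IsLift f k₁ k₂) : IsConformalMap f := by
  choose out hout using X.background.proj_surjective
  have hc : ∀ x ∈ X.cover, deriv k₁ (out (X.background.proj x)).1 *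
      deriv k₂ (out (X.background.proj x)).2 = deriv k₁ x.1 * deriv k₂ x.2 := by
    intro x hx
    have hd := Background.proj_eq_iff.1 (hout (X.background.proj x)).symm
    obtain ⟨d', -, h1, h2⟩ := h.exists_deck hd
    congr 1
    · have e : (fun s => k₁ (s + (out (X.background.proj x) - x).1)) =ᶠ[𝓝 x.1]
          fun s => k₁ s + d'.1 := by
        filter_upwards [X.isOpen_plus.mem_nhds (fst_mem_plus hx)] with s hs using h1 s hs
      have := e.deriv_eq
      rw [deriv_add_const, deriv_comp_add_const] at this
      simpa using this
    · have e : (fun s => k₂ (s + (out (X.background.proj x) - x).2)) =ᶠ[𝓝 x.2]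
          fun s => k₂ s + d'.2 := by
        filter_upwards [X.isOpen_minus.mem_nhds (snd_mem_minus hx)] with s hs using h2 s hs
      have := e.deriv_eq
      rw [deriv_add_const, deriv_comp_add_const] at this
      simpa using this
  refine ⟨fun p => deriv k₁ (out p).1 * deriv k₂ (out p).2, fun p hp => ?_, ?_, fun x hx => ?_⟩
  · obtain ⟨x, rfl⟩ := X.background.proj_surjective p
    dsimp only
    rw [hc x hp]
    exact mul_pos (h.smooth_plus _ (fst_mem_plus hp)).2 (h.smooth_minus _ (snd_mem_minus hp)).2
  · refine ContDiffOn.congr (f := fun x : ℝ × ℝ => deriv k₁ x.1 * deriv k₂ x.2) (fun x hx => ?_) hc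
    have h1 : ContDiffAt ℝ ∞ (deriv k₁) x.1 :=
      ((h.smooth_plus _ (fst_mem_plus hx)).1.fderiv_right (m := ∞) (by simp)).clm_apply
        contDiffAt_const
    have h2 : ContDiffAt ℝ ∞ (deriv k₂) x.2 :=
      ((h.smooth_minus _ (snd_mem_minus hx)).1.fderiv_right (m := ∞) (by simp)).clm_apply
        contDiffAt_const
    exact ((h1.comp x contDiffAt_fst).mul (h2.comp x contDiffAt_snd)).contDiffWithinAt
  · have h1 := h.smooth_plus _ (fst_mem_plus (X := X) hx)
    have h2 := h.smooth_minus _ (snd_mem_minus (X := X) hx)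
    refine ⟨fun x => (k₁ x.1, k₂ x.2), Eventually.of_forall fun y hy => (h.apply_proj hy).symm,
      (h1.1.comp x contDiffAt_fst).prodMk (h2.1.comp x contDiffAt_snd), ?_⟩
    have hF : HasFDerivAt (fun x : ℝ × ℝ => (k₁ x.1, k₂ x.2))
        ((deriv k₁ x.1 • ContinuousLinearMap.fst ℝ ℝ ℝ).prod
          (deriv k₂ x.2 • ContinuousLinearMap.snd ℝ ℝ ℝ)) x :=
      ((h1.1.differentiableAt (by simp)).hasDerivAt.comp_hasFDerivAt x hasFDerivAt_fst).prodMk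
        ((h2.1.differentiableAt (by simp)).hasDerivAt.comp_hasFDerivAt x hasFDerivAt_snd)
    have ha := h1.2
    have hb := h2.2
    rw [hF.fderiv]
    dsimp only
    rw [hc x hx]
    generalize deriv k₁ x.1 = a at *
    generalize deriv k₂ x.2 = b at *
    refine ⟨fun v w => ?_, fun v w hvw => ?_, fun v hv => ?_⟩
    · simp [metric]
      ring
    · simp only [areaForm, ContinuousLinearMap.prod_apply, smul_apply,
        ContinuousLinearMap.coe_fst', ContinuousLinearMap.coe_snd', smul_eq_mul] at hvw ⊢
      have := mul_pos (mul_pos ha hb) hvw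
      linarith
    · obtain ⟨⟨hv1, hv2⟩, hv3⟩ := isFutureCausal_iff.1 hv
      simp only [timeForm, ContinuousLinearMap.prod_apply, smul_apply,
        ContinuousLinearMap.coe_fst', ContinuousLinearMap.coe_snd', smul_eq_mul]
      have e1 : 0 ≤ a * v.1 := mul_nonneg ha.le hv1
      have e2 : 0 ≤ b * v.2 := mul_nonneg hb.le hv2
      by_contra! hle
      have e3 : v.1 = 0 := (mul_eq_zero.1 (le_antisymm (by linarith) e1)).resolve_left ha.ne'
      have e4 : v.2 = 0 := (mul_eq_zero.1 (le_antisymm (by linarith) e2)).resolve_left hb.ne'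
      linarith

end IsLift

end C2

/-! ### Translates of the image of a morphism -/

/-- Disjoint translates of an interval are ordered as a whole. -/
lemma le_of_add_le_add_of_ne {J : Set ℝ} (hJ : J.OrdConnected) {a b u v : ℝ} (hu : u ∈ J)
    (hv : v ∈ J) (h : u + a ≤ v + b) (hne : ∀ i ∈ J, ∀ j ∈ J, i + a ≠ j + b) : a ≤ b := by
  by_contra! hab
  exact hne (v + b - a) (hJ.out hu hv ⟨by linarith, by linarith⟩) v hv (by ring)

namespace C2

variable {X Y : C2}

lemma Hom.causallyConvex_univ (f : Hom X Y) : IsCausallyConvexIn univ (image f.toFun) :=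
  Y.causallyConvex.trans f.causallyConvex (by rintro - ⟨q, -, rfl⟩; exact q.2)

/-- If a causal segment of the image of a morphism meets both the lift of the source and its
translate by `d`, then this translation comes from a deck translation of the source: distinct
translates of the lift are disjoint open sets. -/
lemma IsLift.exists_deck_of_isPreconnected {f : Hom X Y} {k₁ k₂ : ℝ → ℝ} (h : IsLift f.toFun k₁ k₂)
    {P : Set (ℝ × ℝ)} (hP : _root_.IsPreconnected P)
    (hPf : P ⊆ Y.background.proj ⁻¹' image f.toFun) {x y d : ℝ × ℝ} (hx : x ∈ X.cover)
    (hy : y ∈ X.cover) (hd : d ∈ Y.background.deck) (hxP : (k₁ x.1, k₂ x.2) ∈ P)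
    (hyP : (k₁ y.1, k₂ y.2) + d ∈ P) : ∃ d₀ ∈ X.background.deck,
      (∀ s ∈ X.plus, k₁ (s + d₀.1) = k₁ s + d.1) ∧ ∀ t ∈ X.minus, k₂ (t + d₀.2) = k₂ t + d.2 := by
  -- by injectivity of `f`, two points of the lift that differ by a deck translation of the target
  -- come from points that differ by a deck translation of the source
  have key : ∀ a ∈ X.cover, ∀ b ∈ X.cover, ∀ e ∈ Y.background.deck,
      (k₁ a.1, k₂ a.2) = (k₁ b.1, k₂ b.2) + e → ∃ d₀ ∈ X.background.deck,
      (∀ s ∈ X.plus, k₁ (s + d₀.1) = k₁ s + e.1) ∧ ∀ t ∈ X.minus, k₂ (t + d₀.2) = k₂ t + e.2 := by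
    intro a ha b hb e he hab
    have h1 : f.toFun ⟨_, ha⟩ = f.toFun ⟨_, hb⟩ := Subtype.ext (by
      rw [h.apply_proj ha, h.apply_proj hb, hab, Background.proj_add _ he])
    have h2 := Background.proj_eq_iff.1 (congrArg Subtype.val (f.isEmbedding.injective h1)).symm
    obtain ⟨e', -, h3, h4⟩ := h.exists_deck h2
    have h5 := h3 _ (fst_mem_plus hb)
    have h6 := h4 _ (snd_mem_minus hb)
    simp only [Prod.fst_sub, Prod.snd_sub, add_sub_cancel] at h5 h6
    have h7 := congrArg Prod.fst hab
    have h8 := congrArg Prod.snd hab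
    simp only [Prod.fst_add, Prod.snd_add] at h7 h8
    have e1 : e'.1 = e.1 := by linarith
    have e2 : e'.2 = e.2 := by linarith
    exact ⟨_, h2, fun s hs => by rw [h3 s hs, e1], fun t ht => by rw [h4 t ht, e2]⟩
  let A : Set (ℝ × ℝ) := (fun x : ℝ × ℝ => (k₁ x.1, k₂ x.2)) '' X.cover
  have hA : IsOpen A := h.isOpen_image X.isOpen_cover subset_rfl
  have hsub : P ⊆ A := by
    refine subset_of_subset_iUnion_of_inter_nonempty
      (T := fun e : Y.background.deck => (fun z => z - (e : ℝ × ℝ)) ⁻¹' A) hP hA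
      (fun e => hA.preimage (by fun_prop)) ?_ ?_ ⟨_, hxP, mem_image_of_mem _ hx⟩
    · rintro ⟨e, he⟩ ⟨z, ⟨b, hb, hbz⟩, ⟨a, ha, haz⟩⟩ w ⟨u, hu, huw⟩
      dsimp only at hbz haz huw
      obtain ⟨d₀, hd₀, h1, h2⟩ := key a ha b hb e he (by rw [haz, hbz, sub_add_cancel])
      refine ⟨u + d₀, (add_mem_cover hd₀).2 hu, ?_⟩
      simp only [Prod.fst_add, Prod.snd_add]
      rw [h1 _ (fst_mem_plus hu), h2 _ (snd_mem_minus hu),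
        show (k₁ u.1 + e.1, k₂ u.2 + e.2) = (k₁ u.1, k₂ u.2) + e from rfl, huw]
      abel
    · intro z hz
      obtain ⟨u, hu, e, he, rfl⟩ := h.mem_image_iff.1 (hPf hz)
      exact mem_iUnion.2 ⟨⟨e, he⟩, ⟨u, hu, (add_sub_cancel_right _ _).symm⟩⟩
  obtain ⟨a, ha, hay⟩ := hsub hyP
  exact key a ha y hy d hd hay

/-- If the `x⁺`-range of the lift meets its translate, then the translation comes from the
source. -/
lemma IsLift.exists_deck_of_plus {f : Hom X Y} {k₁ k₂ : ℝ → ℝ} (h : IsLift f.toFun k₁ k₂)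
    {s s' : ℝ} {d : ℝ × ℝ} (hs : s ∈ X.plus) (hs' : s' ∈ X.plus) (hd : d ∈ Y.background.deck)
    (hss : k₁ s = k₁ s' + d.1) : ∃ d₀ ∈ X.background.deck,
      (∀ s ∈ X.plus, k₁ (s + d₀.1) = k₁ s + d.1) ∧ ∀ t ∈ X.minus, k₂ (t + d₀.2) = k₂ t + d.2 := by
  obtain ⟨t, ht⟩ := exists_of_mem_plus hs
  obtain ⟨t', ht'⟩ := exists_of_mem_plus hs'
  have hconv := ordConnected_preimage h.isOpen_image_carrier f.causallyConvex_univ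
  have hP : {u | (k₁ s, u) ∈ Y.background.proj ⁻¹' image f.toFun}.OrdConnected :=
    ⟨fun _ ha _ hb _ hc => hconv.out ha hb ⟨⟨le_rfl, hc.1⟩, ⟨le_rfl, hc.2⟩⟩⟩
  refine h.exists_deck_of_isPreconnected
    (hP.isPreconnected.image (fun u => (k₁ s, u)) (by fun_prop))
    (by rintro - ⟨u, hu, rfl⟩; exact hu) ht ht' hd ⟨k₂ t, ?_, rfl⟩
    ⟨k₂ t' + d.2, ?_, Prod.ext hss rfl⟩
  · exact h.mem_image_iff.2 ⟨_, ht, 0, zero_mem _, by simp⟩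
  · exact h.mem_image_iff.2 ⟨_, ht', d, hd, Prod.ext hss rfl⟩

/-- If the `x⁻`-range of the lift meets its translate, then the translation comes from the
source. -/
lemma IsLift.exists_deck_of_minus {f : Hom X Y} {k₁ k₂ : ℝ → ℝ} (h : IsLift f.toFun k₁ k₂)
    {s s' : ℝ} {d : ℝ × ℝ} (hs : s ∈ X.minus) (hs' : s' ∈ X.minus) (hd : d ∈ Y.background.deck)
    (hss : k₂ s = k₂ s' + d.2) : ∃ d₀ ∈ X.background.deck,
      (∀ s ∈ X.plus, k₁ (s + d₀.1) = k₁ s + d.1) ∧ ∀ t ∈ X.minus, k₂ (t + d₀.2) = k₂ t + d.2 := by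
  obtain ⟨t, ht⟩ := exists_of_mem_minus hs
  obtain ⟨t', ht'⟩ := exists_of_mem_minus hs'
  have hconv := ordConnected_preimage h.isOpen_image_carrier f.causallyConvex_univ
  have hP : {u | (u, k₂ s) ∈ Y.background.proj ⁻¹' image f.toFun}.OrdConnected :=
    ⟨fun _ ha _ hb _ hc => hconv.out ha hb ⟨⟨hc.1, le_rfl⟩, ⟨hc.2, le_rfl⟩⟩⟩
  refine h.exists_deck_of_isPreconnected
    (hP.isPreconnected.image (fun u => (u, k₂ s)) (by fun_prop))
    (by rintro - ⟨u, hu, rfl⟩; exact hu) ht ht' hd ⟨k₁ t, ?_, rfl⟩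
    ⟨k₁ t' + d.1, ?_, Prod.ext rfl hss⟩
  · exact h.mem_image_iff.2 ⟨_, ht, 0, zero_mem _, by simp⟩
  · exact h.mem_image_iff.2 ⟨_, ht', d, hd, Prod.ext rfl hss⟩

/-! ### The Cauchy development as an object of `C2` -/

lemma proj_mem_cauchyDevelopment (X : C2) {x : ℝ × ℝ} :
    X.background.proj x ∈ cauchyDevelopment X.carrier ↔ x ∈ X.plus ×ˢ X.minus := by
  rw [cauchyDevelopment_carrier, proj_mem_image_prod_iff]

lemma subset_cauchyDevelopment {B : Background} (S : Set B.Spacetime) :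
    S ⊆ cauchyDevelopment S := by
  rintro p hp γ I - ⟨t, ht, rfl⟩
  exact ⟨t, ht, hp⟩

/-- The Cauchy development of an object, in its ambient spacetime, as an object. -/
def completion (X : C2) : C2 where
  background := X.background
  carrier := cauchyDevelopment X.carrier
  isOpen := by
    rw [cauchyDevelopment_carrier]
    exact X.background.isOpenMap_proj _ (X.isOpen_plus.prod X.isOpen_minus)
  isConnected := by
    rw [cauchyDevelopment_carrier]
    have hsub : X.cover ⊆ X.plus ×ˢ X.minus := fun x hx => ⟨fst_mem_plus hx, snd_mem_minus hx⟩
    refine ⟨(X.nonempty_cover.mono hsub).image _,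
      (IsPreconnected.prod ?_ ?_).image _ X.background.continuous_proj.continuousOn⟩
    · exact X.ordConnected_plus.isPreconnected
    · exact X.ordConnected_minus.isPreconnected
  causallyConvex := by
    refine isCausallyConvexIn_univ_of_ordConnected ?_
    have : X.background.proj ⁻¹' cauchyDevelopment X.carrier = X.plus ×ˢ X.minus :=
      ext fun x => X.proj_mem_cauchyDevelopment
    rw [this]
    exact ⟨fun a ha b hb c hc => ⟨X.ordConnected_plus.out ha.1 hb.1 ⟨hc.1.1, hc.2.1⟩,
      X.ordConnected_minus.out ha.2 hb.2 ⟨hc.1.2, hc.2.2⟩⟩⟩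
  cauchy hX := by
    obtain ⟨S, hS, hS'⟩ := X.cauchy hX
    exact ⟨S, hS.trans (subset_cauchyDevelopment _), hS'⟩

lemma mem_cover_completion {x : ℝ × ℝ} : x ∈ X.completion.cover ↔ x ∈ X.plus ×ˢ X.minus :=
  X.proj_mem_cauchyDevelopment

lemma cover_subset_cover_completion : X.cover ⊆ X.completion.cover := fun _ hx =>
  mem_cover_completion.2 ⟨fst_mem_plus hx, snd_mem_minus hx⟩

lemma plus_completion (X : C2) : X.completion.plus = X.plus := by
  apply Subset.antisymm
  · rintro - ⟨x, hx, rfl⟩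
    exact (mem_cover_completion.1 hx).1
  · exact image_mono cover_subset_cover_completion

lemma minus_completion (X : C2) : X.completion.minus = X.minus := by
  apply Subset.antisymm
  · rintro - ⟨x, hx, rfl⟩
    exact (mem_cover_completion.1 hx).2
  · exact image_mono cover_subset_cover_completion

lemma cauchyStable_iff : cauchyStable X ↔ cauchyDevelopment X.carrier = X.carrier := by
  constructor
  · intro h
    exact eq_of_heq (Sigma.mk.inj h).2
  · intro h
    exact congrArg (Sigma.mk X.background) h

lemma mem_cover_of_cauchyStable (h : cauchyStable X) {x : ℝ × ℝ} :
    x ∈ X.cover ↔ x ∈ X.plus ×ˢ X.minus := by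
  rw [mem_cover, ← cauchyStable_iff.1 h, proj_mem_cauchyDevelopment]

lemma cauchyStable_completion (X : C2) : cauchyStable X.completion := by
  rw [cauchyStable_iff, cauchyDevelopment_carrier, plus_completion, minus_completion]
  exact X.cauchyDevelopment_carrier.symm

lemma image_inclusion (X : C2) :
    image (inclusion (subset_cauchyDevelopment X.carrier) :
      X.carrier → X.completion.carrier) = X.carrier := by
  ext p
  constructor
  · rintro ⟨-, ⟨q, rfl⟩, rfl⟩
    exact q.2
  · exact fun hp => ⟨_, ⟨⟨p, hp⟩, rfl⟩, rfl⟩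

/-- The inclusion of an object into its Cauchy development. -/
def toCompletion (X : C2) : X ⟶ X.completion where
  toFun := inclusion (subset_cauchyDevelopment X.carrier)
  isEmbedding := IsEmbedding.inclusion (subset_cauchyDevelopment X.carrier)
  isConformalMap := by
    obtain ⟨c, h1, h2, h3⟩ := isConformalMap_id X
    refine ⟨c, h1, h2, fun x hx => ?_⟩
    obtain ⟨F, h4, h5⟩ := h3 x hx
    exact ⟨F, h4, h5⟩
  causallyConvex := by
    rw [image_inclusion]
    exact X.causallyConvex.restrict

end C2

/-! ### Extension of morphisms to Cauchy developments -/

namespace C2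

variable {X Y Z : C2}

/-- The underlying map of the extension of a morphism to the Cauchy development: a map with the
same lift to the plane. -/
lemma IsLift.exists_extension {f : X.carrier → Z.carrier} {k₁ k₂ : ℝ → ℝ} (h : IsLift f k₁ k₂)
    (hZ : cauchyStable Z) : ∃ g : X.completion.carrier → Z.carrier, IsLift g k₁ k₂ := by
  have hmem : ∀ x ∈ X.completion.cover, (k₁ x.1, k₂ x.2) ∈ Z.cover := fun x hx => by
    rw [mem_cover_completion] at hx
    exact (mem_cover_of_cauchyStable hZ).2 ⟨h.mem_plus hx.1, h.mem_minus hx.2⟩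
  choose out hout using X.completion.background.proj_surjective
  have hout' : ∀ p : X.completion.carrier, out p.1 ∈ X.completion.cover := fun p => by
    rw [mem_cover]
    exact (hout p.1).symm ▸ p.2
  refine ⟨fun p => ⟨_, hmem _ (hout' p)⟩, by rw [plus_completion]; exact h.smooth_plus,
    by rw [minus_completion]; exact h.smooth_minus, fun x hx => ?_⟩
  rw [onCover_of_mem _ hx]
  have hd := Background.proj_eq_iff.1 (hout (X.completion.background.proj x)).symm
  obtain ⟨d', hd', h1, h2⟩ := h.exists_deck hd
  have hx' := mem_cover_completion.1 hx
  have h3 := h1 _ hx'.1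
  have h4 := h2 _ hx'.2
  simp only [Prod.fst_sub, Prod.snd_sub, add_sub_cancel] at h3 h4
  refine Eq.trans ?_ (Background.proj_add (k₁ x.1, k₂ x.2) hd')
  exact congrArg Z.background.proj (Prod.ext h3 h4)

/-- A map on the Cauchy development that has the same lift as a morphism is a morphism. -/
lemma IsLift.exists_hom_extension {f : Hom X Z} {k₁ k₂ : ℝ → ℝ} (h : IsLift f.toFun k₁ k₂)
    {g : X.completion.carrier → Z.carrier} (hg : IsLift g k₁ k₂) :
    ∃ g' : Hom X.completion Z, g'.toFun = g := by
  have hinj : Function.Injective g := by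
    rintro ⟨p, hp⟩ ⟨q, hq⟩ hpq
    obtain ⟨x, rfl⟩ := X.background.proj_surjective p
    obtain ⟨y, rfl⟩ := X.background.proj_surjective q
    have hx := mem_cover_completion.1 hp
    have hy := mem_cover_completion.1 hq
    have e := congrArg Subtype.val hpq
    have e' := Background.proj_eq_iff.1
      (((hg.apply_proj hp).symm.trans e).trans (hg.apply_proj hq)).symm
    obtain ⟨d₀, hd₀, h1, h2⟩ := h.exists_deck_of_plus hx.1 hy.1 e' (by simp)
    have e1 : k₁ (y.1 + d₀.1) = k₁ x.1 := by rw [h1 _ hy.1]; simp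
    have e2 : k₂ (y.2 + d₀.2) = k₂ x.2 := by rw [h2 _ hy.2]; simp
    have e3 := (h.smooth_plus.strictMonoOn X.ordConnected_plus).injOn
      (add_mem_plus hd₀ hy.1) hx.1 e1
    have e4 := (h.smooth_minus.strictMonoOn X.ordConnected_minus).injOn
      (add_mem_minus hd₀ hy.2) hx.2 e2
    obtain rfl : y + d₀ = x := Prod.ext e3 e4
    exact Subtype.ext (Background.proj_add y hd₀)
  refine ⟨⟨g, hg.isEmbedding hinj, hg.isConformalMap, ?_⟩, rfl⟩
  refine (isCausallyConvexIn_univ_of_ordConnected ⟨fun r hr q hq z hz => ?_⟩).restrict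
  obtain ⟨x, hx, d, hd, rfl⟩ := hg.mem_image_iff.1 hr
  obtain ⟨y, hy, d', hd', rfl⟩ := hg.mem_image_iff.1 hq
  have hx' := mem_cover_completion.1 hx
  have hy' := mem_cover_completion.1 hy
  have ho1 := h.smooth_plus.ordConnected_image X.ordConnected_plus
  have ho2 := h.smooth_minus.ordConnected_image X.ordConnected_minus
  -- either both endpoints lie in the same translate of the image of the double cone, or the
  -- translates are disjoint in both coordinates
  have hcase : ∃ d₀ ∈ X.background.deck, (∀ s ∈ X.plus, k₁ (s + d₀.1) = k₁ s + (d' - d).1) ∧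
      ∀ t ∈ X.minus, k₂ (t + d₀.2) = k₂ t + (d' - d).2 := by
    by_cases c1 : ∃ i ∈ X.plus, ∃ j ∈ X.plus, k₁ i + d.1 = k₁ j + d'.1
    · obtain ⟨i, hi, j, hj, hij⟩ := c1
      exact h.exists_deck_of_plus hi hj (sub_mem hd' hd) (by rw [Prod.fst_sub]; linarith)
    by_cases c2 : ∃ i ∈ X.minus, ∃ j ∈ X.minus, k₂ i + d.2 = k₂ j + d'.2
    · obtain ⟨i, hi, j, hj, hij⟩ := c2
      exact h.exists_deck_of_minus hi hj (sub_mem hd' hd) (by rw [Prod.snd_sub]; linarith)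
    push Not at c1 c2
    have l1 : d.1 ≤ d'.1 := le_of_add_le_add_of_ne ho1 (mem_image_of_mem _ hx'.1)
      (mem_image_of_mem _ hy'.1) (hz.1.1.trans hz.2.1) (by
        rintro - ⟨i, hi, rfl⟩ - ⟨j, hj, rfl⟩
        exact c1 i hi j hj)
    have l2 : d.2 ≤ d'.2 := le_of_add_le_add_of_ne ho2 (mem_image_of_mem _ hx'.2)
      (mem_image_of_mem _ hy'.2) (hz.1.2.trans hz.2.2) (by
        rintro - ⟨i, hi, rfl⟩ - ⟨j, hj, rfl⟩
        exact c2 i hi j hj)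
    -- the coordinates of a deck translation add up to zero, so that `d = d'`
    have s1 := Background.sum_eq_zero_of_mem_deck hd
    have s2 := Background.sum_eq_zero_of_mem_deck hd'
    exact absurd (by linarith) (c1 x.1 hx'.1 x.1 hx'.1)
  obtain ⟨d₀, hd₀, h1, h2⟩ := hcase
  have h3 := h1 _ hy'.1
  have h4 := h2 _ hy'.2
  simp only [Prod.fst_sub, Prod.snd_sub] at h3 h4
  obtain ⟨⟨z1, z2⟩, ⟨z3, z4⟩⟩ := hz
  simp only [Prod.fst_add, Prod.snd_add] at z1 z2 z3 z4
  obtain ⟨u, hu, hu'⟩ := ho1.out (mem_image_of_mem _ hx'.1)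
    (mem_image_of_mem _ (add_mem_plus hd₀ hy'.1))
    (show z.1 - d.1 ∈ _ from ⟨by linarith, by linarith⟩)
  obtain ⟨v, hv, hv'⟩ := ho2.out (mem_image_of_mem _ hx'.2)
    (mem_image_of_mem _ (add_mem_minus hd₀ hy'.2))
    (show z.2 - d.2 ∈ _ from ⟨by linarith, by linarith⟩)
  refine hg.mem_image_iff.2 ⟨(u, v), mem_cover_completion.2 ⟨hu, hv⟩, d, hd, ?_⟩
  exact Prod.ext (by simp [hu']) (by simp [hv'])

lemma exists_toCompletion_comp_eq (f : X ⟶ Z) (hZ : cauchyStable Z) :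
    ∃ g : X.completion ⟶ Z, X.toCompletion ≫ g = f := by
  obtain ⟨k₁, k₂, h⟩ := IsConformalMap.exists_isLift (Hom.isConformalMap f)
  obtain ⟨g, hg⟩ := h.exists_extension hZ
  obtain ⟨g', rfl⟩ := h.exists_hom_extension hg
  refine ⟨g', Hom.ext (funext ?_)⟩
  rintro ⟨p, hp⟩
  obtain ⟨x, rfl⟩ := X.background.proj_surjective p
  exact Subtype.ext
    ((hg.apply_proj (cover_subset_cover_completion hp)).trans (h.apply_proj hp).symm)

lemma toCompletion_comp_injective {g g' : X.completion ⟶ Z}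
    (hgg : X.toCompletion ≫ g = X.toCompletion ≫ g') : g = g' := by
  obtain ⟨k₁, k₂, h⟩ := IsConformalMap.exists_isLift (Hom.isConformalMap g)
  obtain ⟨l₁, l₂, h'⟩ := IsConformalMap.exists_isLift (Hom.isConformalMap g')
  have hp := X.plus_completion
  have hm := X.minus_completion
  obtain ⟨d, hd, h1, h2⟩ := exists_deck_of_proj_eq (X := X) (B := Z.background)
    (hp ▸ h.smooth_plus.continuousOn) (hm ▸ h.smooth_minus.continuousOn)
    (hp ▸ h'.smooth_plus.continuousOn) (hm ▸ h'.smooth_minus.continuousOn) (fun x hx => by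
      rw [← h.apply_proj (cover_subset_cover_completion hx),
        ← h'.apply_proj (cover_subset_cover_completion hx)]
      exact congrArg Subtype.val (congrFun (congrArg Hom.toFun hgg) ⟨_, hx⟩))
  refine Hom.ext (funext ?_)
  rintro ⟨p, hp⟩
  obtain ⟨x, rfl⟩ := X.background.proj_surjective p
  have hx := mem_cover_completion.1 hp
  refine Subtype.ext ((h.apply_proj hp).trans (Eq.trans ?_ (h'.apply_proj hp).symm))
  rw [h1 _ hx.1, h2 _ hx.2]
  exact Background.proj_add (l₁ x.1, l₂ x.2) hd

/-! ### Cauchy morphisms become invertible -/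

/-- A morphism between stable objects is invertible if it is onto in both light-cone
coordinates. -/
lemma isIso_of_image_eq {f : X ⟶ Y} (hX : cauchyStable X) {k₁ k₂ : ℝ → ℝ}
    (h : IsLift (map f) k₁ k₂) (h₁ : k₁ '' X.plus = Y.plus) (h₂ : k₂ '' X.minus = Y.minus) :
    IsIso f := by
  have hl₁ := (h.smooth_plus.strictMonoOn X.ordConnected_plus).injOn.leftInvOn_invFunOn
  have hl₂ := (h.smooth_minus.strictMonoOn X.ordConnected_minus).injOn.leftInvOn_invFunOn
  set l₁ := Function.invFunOn k₁ X.plus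
  set l₂ := Function.invFunOn k₂ X.minus
  have hl : ∀ y ∈ Y.cover, (l₁ y.1, l₂ y.2) ∈ X.cover ∧ (k₁ (l₁ y.1), k₂ (l₂ y.2)) = y := by
    intro y hy
    obtain ⟨s, hs, e₁⟩ : y.1 ∈ k₁ '' X.plus := h₁ ▸ fst_mem_plus hy
    obtain ⟨t, ht, e₂⟩ : y.2 ∈ k₂ '' X.minus := h₂ ▸ snd_mem_minus hy
    rw [mem_cover_of_cauchyStable hX, ← e₁, ← e₂, hl₁ hs, hl₂ ht]
    exact ⟨⟨hs, ht⟩, Prod.ext e₁ e₂⟩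
  have hfl : ∀ y, ∀ hy : y ∈ Y.cover, map f ⟨_, (hl y hy).1⟩ = ⟨_, hy⟩ := fun y hy =>
    Subtype.ext ((h.apply_proj (hl y hy).1).trans (by rw [(hl y hy).2]))
  have hinj : Function.Injective (map f) := (Hom.isEmbedding f).injective
  have hsurj : Function.Surjective (map f) := by
    rintro ⟨p, hp⟩
    obtain ⟨y, rfl⟩ := Y.background.proj_surjective p
    exact ⟨_, hfl y hp⟩
  let e := Equiv.ofBijective (map f) ⟨hinj, hsurj⟩
  have hg : IsLift e.symm l₁ l₂ := by
    refine ⟨?_, ?_, fun y hy => ?_⟩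
    · rw [← h₁]
      exact h.smooth_plus.of_leftInverse X.isOpen_plus hl₁
    · rw [← h₂]
      exact h.smooth_minus.of_leftInverse X.isOpen_minus hl₂
    · rw [onCover_of_mem _ hy, ← hfl y hy]
      exact congrArg Subtype.val (e.symm_apply_apply _)
  let g : Y ⟶ X := ⟨e.symm, hg.isEmbedding e.symm.injective, hg.isConformalMap, by
    have : image e.symm = X.carrier := by
      rw [image, e.symm.surjective.range_eq, image_univ, Subtype.range_coe]
    rw [this]
    exact X.causallyConvex.restrict⟩
  exact ⟨g, Hom.ext (funext e.symm_apply_apply), Hom.ext (funext e.apply_symm_apply)⟩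

/-- The extension of a Cauchy morphism to the Cauchy developments is invertible: the null lines
in the target all meet the image, so that the translates of the range of each light-cone coordinate
cover the connected range for the target. -/
lemma isIso_of_cauchyMorphisms {f : X ⟶ Y} (hf : cauchyMorphisms f)
    {g : X.completion ⟶ Y.completion} (hg : X.toCompletion ≫ g = f ≫ Y.toCompletion) : IsIso g := by
  obtain ⟨k₁, k₂, h⟩ := IsConformalMap.exists_isLift (Hom.isConformalMap g)
  obtain ⟨S, hS, -, hS'⟩ := hf
  have himg : ∀ y, Y.background.proj y ∈ image (map f) →
      ∃ x ∈ X.completion.cover, ∃ d ∈ Y.background.deck, y = (k₁ x.1, k₂ x.2) + d := by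
    rintro y ⟨-, ⟨p, rfl⟩, hpy⟩
    refine h.mem_image_iff.1 ⟨_, mem_range_self (X.toCompletion.toFun p), ?_⟩
    refine Eq.trans ?_ hpy
    exact congrArg Subtype.val (congrFun (congrArg Hom.toFun hg) p)
  refine isIso_of_image_eq X.cauchyStable_completion h (Subset.antisymm ?_ ?_)
    (Subset.antisymm ?_ ?_)
  · rintro - ⟨s, hs, rfl⟩
    exact h.mem_plus hs
  · obtain ⟨x₀, hx₀⟩ := X.completion.nonempty_cover
    refine subset_of_subset_iUnion_of_inter_nonempty
      (T := fun d : Y.background.deck =>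
        (fun u => u - (d : ℝ × ℝ).1) ⁻¹' (k₁ '' X.completion.plus))
      Y.completion.ordConnected_plus.isPreconnected
      (h.smooth_plus.isOpen_image X.completion.isOpen_plus)
      (fun d => (h.smooth_plus.isOpen_image X.completion.isOpen_plus).preimage (by fun_prop)) ?_ ?_
      ⟨_, h.mem_plus (fst_mem_plus hx₀), mem_image_of_mem _ (fst_mem_plus hx₀)⟩
    · rintro ⟨d, hd⟩ ⟨z, ⟨s', hs', hz'⟩, ⟨s, hs, hz⟩⟩ w ⟨u, hu, hw⟩
      dsimp only at hz' hw
      obtain ⟨d₀, hd₀, h1, -⟩ := h.exists_deck_of_plus hs hs' hd (by rw [hz, hz']; ring)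
      exact ⟨u + d₀.1, add_mem_plus hd₀ hu, by rw [h1 u hu, hw]; ring⟩
    · intro u hu
      rw [plus_completion] at hu
      obtain ⟨t, ⟨ht, htS⟩, -⟩ := hS' _ _ (Y.isInextensibleCausalCurve_slice_fst hu)
      obtain ⟨x, hx, d, hd, e⟩ := himg _ (hS htS)
      refine mem_iUnion.2 ⟨⟨d, hd⟩, x.1, fst_mem_plus hx, ?_⟩
      have := congrArg Prod.fst e
      simp only [Prod.fst_add] at this
      exact (sub_eq_of_eq_add this).symm
  · rintro - ⟨s, hs, rfl⟩
    exact h.mem_minus hs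
  · obtain ⟨x₀, hx₀⟩ := X.completion.nonempty_cover
    refine subset_of_subset_iUnion_of_inter_nonempty
      (T := fun d : Y.background.deck =>
        (fun u => u - (d : ℝ × ℝ).2) ⁻¹' (k₂ '' X.completion.minus))
      Y.completion.ordConnected_minus.isPreconnected
      (h.smooth_minus.isOpen_image X.completion.isOpen_minus)
      (fun d => (h.smooth_minus.isOpen_image X.completion.isOpen_minus).preimage (by fun_prop))
      ?_ ?_
      ⟨_, h.mem_minus (snd_mem_minus hx₀), mem_image_of_mem _ (snd_mem_minus hx₀)⟩
    · rintro ⟨d, hd⟩ ⟨z, ⟨s', hs', hz'⟩, ⟨s, hs, hz⟩⟩ w ⟨u, hu, hw⟩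
      dsimp only at hz' hw
      obtain ⟨d₀, hd₀, -, h2⟩ := h.exists_deck_of_minus hs hs' hd (by rw [hz, hz']; ring)
      exact ⟨u + d₀.2, add_mem_minus hd₀ hu, by rw [h2 u hu, hw]; ring⟩
    · intro u hu
      rw [minus_completion] at hu
      obtain ⟨t, ⟨ht, htS⟩, -⟩ := hS' _ _ (Y.isInextensibleCausalCurve_slice_snd hu)
      obtain ⟨x, hx, d, hd, e⟩ := himg _ (hS htS)
      refine mem_iUnion.2 ⟨⟨d, hd⟩, x.2, snd_mem_minus hx, ?_⟩
      have := congrArg Prod.snd e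
      simp only [Prod.snd_add] at this
      exact (sub_eq_of_eq_add this).symm

end C2

/-! ### A time function on a connected causally convex plane domain -/

section TimeFunction

open MeasureTheory

/-- A probability measure on the plane that is positive on nonempty open sets and for which null
lines have measure zero: the standard Gaussian measure. -/
def planeMeasure : Measure (ℝ × ℝ) :=
  (ProbabilityTheory.gaussianReal 0 1).prod (ProbabilityTheory.gaussianReal 0 1)

instance : IsProbabilityMeasure planeMeasure := by
  unfold planeMeasure
  infer_instance

instance : planeMeasure.IsOpenPosMeasure := by
  have : (ProbabilityTheory.gaussianReal 0 1).IsOpenPosMeasure :=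
    (ProbabilityTheory.gaussianReal_absolutelyContinuous' 0 one_ne_zero).isOpenPosMeasure
  unfold planeMeasure
  infer_instance

lemma planeMeasure_ae_ne (p : ℝ × ℝ) : ∀ᵐ a ∂planeMeasure, a.1 ≠ p.1 ∧ a.2 ≠ p.2 := by
  have := ProbabilityTheory.nullSingletonClass_gaussianReal (μ := 0) (v := 1) one_ne_zero
  have h1 : planeMeasure ({p.1} ×ˢ univ) = 0 := by
    rw [planeMeasure, Measure.prod_prod, measure_singleton, zero_mul]
  have h2 : planeMeasure (univ ×ˢ {p.2}) = 0 := by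
    rw [planeMeasure, Measure.prod_prod, measure_singleton, mul_zero]
  have h3 := measure_union_null h1 h2
  rw [ae_iff]
  refine measure_mono_null (fun a ha => ?_) h3
  by_contra hb
  refine ha ⟨fun h => hb (Or.inl ⟨h, trivial⟩), fun h => hb (Or.inr ⟨trivial, h⟩)⟩

variable {W : Set (ℝ × ℝ)}

lemma continuous_planeMeasure_inter {R : ℝ × ℝ → Set (ℝ × ℝ)} (hR : ∀ p, MeasurableSet (R p))
    (hW : MeasurableSet W)
    (h : ∀ p a, a.1 ≠ p.1 → a.2 ≠ p.2 → ∀ᶠ q in 𝓝 p, (a ∈ R q ↔ a ∈ R p)) :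
    Continuous fun p => planeMeasure.real (R p ∩ W) := by
  have e : (fun p => planeMeasure.real (R p ∩ W)) =
      fun p => ∫ a, (R p ∩ W).indicator (fun _ => (1 : ℝ)) a ∂planeMeasure := by
    ext p
    rw [integral_indicator_const _ ((hR p).inter hW)]
    simp
  rw [e, continuous_iff_continuousAt]
  intro p
  refine continuousAt_of_dominated (bound := fun _ => 1) (Eventually.of_forall fun q => ?_)
    (Eventually.of_forall fun q => Eventually.of_forall fun a => ?_) (integrable_const 1) ?_
  · exact (aestronglyMeasurable_const.indicator ((hR q).inter hW))
  · exact (norm_indicator_le_norm_self _ _).trans (by simp)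
  · filter_upwards [planeMeasure_ae_ne p] with a ha
    refine ContinuousAt.congr (f := fun _ => (R p ∩ W).indicator (fun _ => (1 : ℝ)) a)
      continuousAt_const ?_
    filter_upwards [h p a ha.1 ha.2] with q hq
    have : a ∈ R q ∩ W ↔ a ∈ R p ∩ W := and_congr_left' hq
    by_cases ha : a ∈ R p ∩ W
    · rw [indicator_of_mem ha, indicator_of_mem (this.2 ha)]
    · rw [indicator_of_notMem ha, indicator_of_notMem (this.not.2 ha)]

/-- The difference of the measures of the past and of the future of a point in the domain `W`.
Its zero set in `W` is Geroch's Cauchy surface. -/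
def balance (W : Set (ℝ × ℝ)) (p : ℝ × ℝ) : ℝ :=
  planeMeasure.real (Iic p ∩ W) - planeMeasure.real (Ici p ∩ W)

lemma eventually_le_iff {a p : ℝ} (h : a ≠ p) :
    ∀ᶠ q in 𝓝 p, (a ≤ q ↔ a ≤ p) ∧ (q ≤ a ↔ p ≤ a) := by
  rcases h.lt_or_gt with h | h
  · filter_upwards [eventually_gt_nhds h] with q hq
    exact ⟨iff_of_true hq.le h.le, iff_of_false hq.not_ge h.not_ge⟩
  · filter_upwards [eventually_lt_nhds h] with q hq
    exact ⟨iff_of_false hq.not_ge h.not_ge, iff_of_true hq.le h.le⟩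

lemma continuous_balance (hW : IsOpen W) : Continuous (balance W) := by
  refine (continuous_planeMeasure_inter (fun p => measurableSet_Iic) hW.measurableSet ?_).sub
    (continuous_planeMeasure_inter (fun p => measurableSet_Ici) hW.measurableSet ?_)
  all_goals
    intro p a h1 h2
    filter_upwards [continuousAt_fst.eventually (eventually_le_iff h1),
      continuousAt_snd.eventually (eventually_le_iff h2)] with q hq1 hq2
    simp only [mem_Iic, mem_Ici, Prod.le_def, hq1.1, hq1.2, hq2.1, hq2.2]

lemma measure_past_pos (hW : IsOpen W) {r p : ℝ × ℝ} (hr : r ∈ W) (hrp : r ≤ p) :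
    0 < planeMeasure.real (Iic p ∩ W) := by
  obtain ⟨ε, hε, h, -⟩ := exists_pos_shift_mem hW hr
  have ho : IsOpen (W ∩ (Iio r.1 ×ˢ Iio r.2)) := hW.inter (isOpen_Iio.prod isOpen_Iio)
  have hpos : 0 < planeMeasure (W ∩ (Iio r.1 ×ˢ Iio r.2)) :=
    ho.measure_pos _ ⟨_, h, by simp [hε], by simp [hε]⟩
  refine ENNReal.toReal_pos (hpos.trans_le (measure_mono ?_)).ne' (measure_ne_top _ _)
  rintro z ⟨hz, hz1, hz2⟩
  exact ⟨(show z ≤ r from ⟨hz1.le, hz2.le⟩).trans hrp, hz⟩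

lemma measure_future_pos (hW : IsOpen W) {r p : ℝ × ℝ} (hr : r ∈ W) (hrp : p ≤ r) :
    0 < planeMeasure.real (Ici p ∩ W) := by
  obtain ⟨ε, hε, -, h⟩ := exists_pos_shift_mem hW hr
  have ho : IsOpen (W ∩ (Ioi r.1 ×ˢ Ioi r.2)) := hW.inter (isOpen_Ioi.prod isOpen_Ioi)
  have hpos : 0 < planeMeasure (W ∩ (Ioi r.1 ×ˢ Ioi r.2)) :=
    ho.measure_pos _ ⟨_, h, by simp [hε], by simp [hε]⟩
  refine ENNReal.toReal_pos (hpos.trans_le (measure_mono ?_)).ne' (measure_ne_top _ _)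
  rintro z ⟨hz, hz1, hz2⟩
  exact ⟨hrp.trans ⟨hz1.le, hz2.le⟩, hz⟩

lemma balance_lt (hW : IsOpen W) {p q : ℝ × ℝ} (hpq : p < q) (hq : q ∈ W) :
    balance W p < balance W q := by
  have ho : IsOpen (W ∩ (Iic p)ᶜ) := hW.inter isClosed_Iic.isOpen_compl
  obtain ⟨ε, hε, h, -⟩ := exists_pos_shift_mem ho ⟨hq, hpq.not_ge⟩
  have ho' : IsOpen ((W ∩ (Iic p)ᶜ) ∩ (Iio q.1 ×ˢ Iio q.2)) := ho.inter (isOpen_Iio.prod isOpen_Iio)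
  have hpos : 0 < planeMeasure ((W ∩ (Iic p)ᶜ) ∩ (Iio q.1 ×ˢ Iio q.2)) :=
    ho'.measure_pos _ ⟨_, h, by simp [hε], by simp [hε]⟩
  have hpos' := ENNReal.toReal_pos hpos.ne' (measure_ne_top _ _)
  have hdisj : Disjoint (Iic p ∩ W) ((W ∩ (Iic p)ᶜ) ∩ (Iio q.1 ×ˢ Iio q.2)) :=
    disjoint_left.2 fun z hz hz' => hz'.1.2 hz.1
  have h1 := measureReal_union (μ := planeMeasure) hdisj ho'.measurableSet
  have h2 : planeMeasure.real ((Iic p ∩ W) ∪ ((W ∩ (Iic p)ᶜ) ∩ (Iio q.1 ×ˢ Iio q.2))) ≤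
      planeMeasure.real (Iic q ∩ W) := by
    refine measureReal_mono ?_
    rintro z (hz | hz)
    · exact ⟨hz.1.trans hpq.le, hz.2⟩
    · exact ⟨⟨hz.2.1.le, hz.2.2.le⟩, hz.1.1⟩
  have h3 : planeMeasure.real (Ici q ∩ W) ≤ planeMeasure.real (Ici p ∩ W) :=
    measureReal_mono fun z hz => ⟨hpq.le.trans hz.1, hz.2⟩
  have h4 : 0 < planeMeasure.real ((W ∩ (Iic p)ᶜ) ∩ (Iio q.1 ×ˢ Iio q.2)) := hpos'
  simp only [balance]
  linarith

/-- A point on a null line through the domain at which past and future have equal measure lies in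
the domain: both are positive, so that it lies between two points of the domain. -/
lemma mem_of_balance_eq_zero (hW : IsOpen W) (hWc : W.OrdConnected) {p : ℝ × ℝ}
    (hp : p.1 ∈ Prod.fst '' W) (h0 : balance W p = 0) : p ∈ W := by
  obtain ⟨z, hz, hzp⟩ := hp
  have hne : ∀ S : Set (ℝ × ℝ), 0 < planeMeasure.real S → S.Nonempty := by
    intro S hS
    by_contra hemp
    rw [not_nonempty_iff_eq_empty.1 hemp] at hS
    simp at hS
  rw [balance, sub_eq_zero] at h0
  rcases le_total p.2 z.2 with h | h
  · have h1 := measure_future_pos hW hz (p := p) ⟨hzp.ge, h⟩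
    obtain ⟨a, hap, ha⟩ := hne _ (h0 ▸ h1)
    exact hWc.out ha hz ⟨hap, hzp.ge, h⟩
  · have h1 := measure_past_pos hW hz (p := p) ⟨hzp.le, h⟩
    obtain ⟨b, hpb, hb⟩ := hne _ (h0 ▸ h1)
    exact hWc.out hz hb ⟨⟨hzp.le, h⟩, hpb⟩

lemma exists_balance_pos (hW : IsOpen W) {I : Set ℝ} [I.OrdConnected] {l : ℝ → ℝ × ℝ}
    (hl : MonotoneOn l I) (h1 : ∃ t ∈ I, ∃ r ∈ W, r ≤ l t) (h2 : ∀ x ∈ W, ∃ t ∈ I, ¬ l t ≤ x) :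
    ∃ t ∈ I, 0 ≤ balance W (l t) := by
  obtain ⟨t₀, ht₀, r, hr, hrt⟩ := h1
  have hne : Nonempty I := ⟨⟨t₀, ht₀⟩⟩
  have hlim := tendsto_measure_iInter_atTop (μ := planeMeasure) (s := fun t : I => Ici (l t) ∩ W)
    (fun t => (measurableSet_Ici.inter hW.measurableSet).nullMeasurableSet)
    (fun s t hst z hz => ⟨(hl s.2 t.2 hst).trans hz.1, hz.2⟩) ⟨⟨t₀, ht₀⟩, measure_ne_top _ _⟩
  have hemp : ⋂ t : I, Ici (l t) ∩ W = ∅ := by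
    refine eq_empty_of_forall_notMem fun x hx => ?_
    have hx' := mem_iInter.1 hx
    obtain ⟨t, ht, htx⟩ := h2 x (hx' ⟨t₀, ht₀⟩).2
    exact htx (hx' ⟨t, ht⟩).1
  rw [hemp, measure_empty] at hlim
  have hpos := measure_past_pos hW hr hrt
  have hlim' := (ENNReal.tendsto_toReal ENNReal.zero_ne_top).comp hlim
  obtain ⟨t, htt, ht⟩ := ((hlim'.eventually_lt_const (show _ < _ from hpos)).and
    (eventually_ge_atTop ⟨t₀, ht₀⟩)).exists
  refine ⟨t, t.2, ?_⟩
  have h3 : planeMeasure.real (Iic (l t₀) ∩ W) ≤ planeMeasure.real (Iic (l t) ∩ W) :=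
    measureReal_mono fun z hz => ⟨le_trans hz.1 (hl ht₀ t.2 ht), hz.2⟩
  have h4 : planeMeasure.real (Ici (l t) ∩ W) < planeMeasure.real (Iic (l t₀) ∩ W) := htt
  rw [balance]
  linarith

lemma exists_balance_neg (hW : IsOpen W) {I : Set ℝ} [I.OrdConnected] {l : ℝ → ℝ × ℝ}
    (hl : MonotoneOn l I) (h1 : ∃ t ∈ I, ∃ r ∈ W, l t ≤ r) (h2 : ∀ x ∈ W, ∃ t ∈ I, ¬ x ≤ l t) :
    ∃ t ∈ I, balance W (l t) ≤ 0 := by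
  obtain ⟨t₀, ht₀, r, hr, hrt⟩ := h1
  have hne : Nonempty I := ⟨⟨t₀, ht₀⟩⟩
  have hlim := tendsto_measure_iInter_atBot (μ := planeMeasure) (s := fun t : I => Iic (l t) ∩ W)
    (fun t => (measurableSet_Iic.inter hW.measurableSet).nullMeasurableSet)
    (fun s t hst z hz => ⟨le_trans hz.1 (hl s.2 t.2 hst), hz.2⟩) ⟨⟨t₀, ht₀⟩, measure_ne_top _ _⟩
  have hemp : ⋂ t : I, Iic (l t) ∩ W = ∅ := by
    refine eq_empty_of_forall_notMem fun x hx => ?_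
    have hx' := mem_iInter.1 hx
    obtain ⟨t, ht, htx⟩ := h2 x (hx' ⟨t₀, ht₀⟩).2
    exact htx (hx' ⟨t, ht⟩).1
  rw [hemp, measure_empty] at hlim
  have hpos := measure_future_pos hW hr hrt
  have hlim' := (ENNReal.tendsto_toReal ENNReal.zero_ne_top).comp hlim
  obtain ⟨t, htt, ht⟩ := ((hlim'.eventually_lt_const (show _ < _ from hpos)).and
    (eventually_le_atBot ⟨t₀, ht₀⟩)).exists
  refine ⟨t, t.2, ?_⟩
  have h3 : planeMeasure.real (Ici (l t₀) ∩ W) ≤ planeMeasure.real (Ici (l t) ∩ W) :=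
    measureReal_mono fun z hz => ⟨(hl t.2 ht₀ ht).trans hz.1, hz.2⟩
  have h4 : planeMeasure.real (Iic (l t) ∩ W) < planeMeasure.real (Ici (l t₀) ∩ W) := htt
  rw [balance]
  linarith

end TimeFunction

namespace C2

/-- Geroch's surface: in Minkowski spacetime, an object contains a Cauchy surface of its Cauchy
development. -/
lemma isCauchySurface_balance (X : C2) (hX : X.background = .minkowski) :
    IsCauchySurface X.completion.carrier
      (X.background.proj '' {x | x ∈ X.cover ∧ balance X.cover x = 0}) := by
  refine ⟨?_, fun γ I hγ => ?_⟩
  · rintro - ⟨x, ⟨hx, -⟩, rfl⟩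
    exact cover_subset_cover_completion hx
  have hinj := Background.proj_injective hX
  obtain ⟨l, hlc, hlγ, hm, hs, htop, hbot⟩ := hγ.exists_lift
  have hI : I.OrdConnected := hγ.1.1
  have hmem : ∀ t ∈ I, l t ∈ X.completion.cover := fun t ht => by
    rw [mem_cover]
    exact (hlγ t ht).symm ▸ hγ.2.1 t ht
  obtain ⟨t₀, ht₀⟩ := hγ.1.2.1.nonempty
  have hbox := mem_cover_completion.1 (hmem t₀ ht₀)
  -- the lift is neither bounded above nor bounded below by a point of the double cone
  have hup : ∀ x ∈ X.completion.cover, ∃ t ∈ I, ¬ l t ≤ x := by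
    by_contra! hcon
    obtain ⟨x, hx, hle⟩ := hcon
    obtain ⟨p, hpx, hlp, hp⟩ := htop x hle
    exact hp (X.completion.ordConnected_cover.out (hmem t₀ ht₀) hx ⟨hlp t₀ ht₀, hpx⟩)
  have hdown : ∀ x ∈ X.completion.cover, ∃ t ∈ I, ¬ x ≤ l t := by
    by_contra! hcon
    obtain ⟨x, hx, hle⟩ := hcon
    obtain ⟨p, hpx, hlp, hp⟩ := hbot x hle
    exact hp (X.completion.ordConnected_cover.out hx (hmem t₀ ht₀) ⟨hpx, hlp t₀ ht₀⟩)
  obtain ⟨q, hq⟩ := exists_of_mem_plus hbox.1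
  obtain ⟨r, hr⟩ := exists_of_mem_minus hbox.2
  have hr' : r ∈ X.plus := fst_mem_plus hr
  have hq' : q ∈ X.minus := snd_mem_minus hq
  have hqr : (r, q) ∈ X.completion.cover := mem_cover_completion.2 ⟨hr', hq'⟩
  have hpos : ∃ t ∈ I, 0 ≤ balance X.cover (l t) := by
    refine exists_balance_pos X.isOpen_cover hm ?_ fun x hx =>
      hup x (cover_subset_cover_completion hx)
    by_contra! hcon
    have hlt : ∀ t ∈ I, t₀ ≤ t → l t ≤ (r, q) := fun t ht htt => by
      have hle := hm ht₀ ht htt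
      constructor <;> by_contra! h
      · exact hcon t ht _ hr ⟨h.le, hle.2⟩
      · exact hcon t ht _ hq ⟨hle.1, h.le⟩
    obtain ⟨t, ht, hn⟩ := hup _ hqr
    exact hn ((le_total t t₀).elim (fun h => (hm ht ht₀ h).trans (hlt t₀ ht₀ le_rfl)) (hlt t ht))
  have hneg : ∃ t ∈ I, balance X.cover (l t) ≤ 0 := by
    refine exists_balance_neg X.isOpen_cover hm ?_ fun x hx =>
      hdown x (cover_subset_cover_completion hx)
    by_contra! hcon
    have hlt : ∀ t ∈ I, t ≤ t₀ → (r, q) ≤ l t := fun t ht htt => by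
      have hle := hm ht ht₀ htt
      constructor <;> by_contra! h
      · exact hcon t ht _ hr ⟨h.le, hle.2⟩
      · exact hcon t ht _ hq ⟨hle.1, h.le⟩
    obtain ⟨t, ht, hn⟩ := hdown _ hqr
    exact hn ((le_total t₀ t).elim (fun h => (hlt t₀ ht₀ le_rfl).trans (hm ht₀ ht h)) (hlt t ht))
  have hc : ContinuousOn (fun t => balance X.cover (l t)) I :=
    (continuous_balance X.isOpen_cover).comp_continuousOn hlc
  obtain ⟨t₁, ht₁, e₁⟩ := hneg
  obtain ⟨t₂, ht₂, e₂⟩ := hpos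
  obtain ⟨t, ht, e⟩ := (hI.isPreconnected.image _ hc).ordConnected.out
    (mem_image_of_mem _ ht₁) (mem_image_of_mem _ ht₂) ⟨e₁, e₂⟩
  have hzero : ∀ s ∈ I, γ s ∈ X.background.proj '' {x | x ∈ X.cover ∧ balance X.cover x = 0} →
      l s ∈ X.cover ∧ balance X.cover (l s) = 0 := by
    rintro s hs' ⟨x, hx, hxs⟩
    rw [← hinj (hxs.trans (hlγ s hs').symm)]
    exact hx
  refine ⟨t, ⟨ht, l t, ⟨?_, e⟩, hlγ t ht⟩, fun s ⟨hsI, hsS⟩ => ?_⟩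
  · exact mem_of_balance_eq_zero X.isOpen_cover X.ordConnected_cover
      (mem_cover_completion.1 (hmem t ht)).1 e
  · have htS := hzero t ht ⟨l t, ⟨mem_of_balance_eq_zero X.isOpen_cover X.ordConnected_cover
      (mem_cover_completion.1 (hmem t ht)).1 e, e⟩, hlγ t ht⟩
    have hsS' := hzero s hsI hsS
    have hlt : ∀ a ∈ I, ∀ b ∈ I, a < b → l a < l b := fun a ha b hb hab =>
      lt_of_le_of_ne (hm ha hb hab.le) fun he => (hs ha hb hab).ne (by simp only [he])
    rcases lt_trichotomy s t with h | h | h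
    · exact absurd (balance_lt X.isOpen_cover (hlt s hsI t ht h) htS.1)
        (by rw [htS.2, hsS'.2]; simp)
    · exact h
    · exact absurd (balance_lt X.isOpen_cover (hlt t ht s hsI h) hsS'.1)
        (by rw [htS.2, hsS'.2]; simp)

end C2

/-! ### The reflective localization -/

/-- The localization property of a reflector, for a class of morphisms that it inverts and that
contains the unit. -/
lemma isLocalization_of_unit {C D : Type*} [Category* C] [Category* D] {G : C ⥤ D} {F : D ⥤ C}
    (adj : G ⊣ F) [F.Full] [F.Faithful] (W : MorphismProperty C) (hG : W.IsInvertedBy G)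
    (hW : ∀ X, W (adj.unit.app X)) : G.IsLocalization W := by
  have : ∀ X, IsIso ((Functor.whiskerRight adj.unit W.Q).app X) := fun X =>
    Localization.inverts W.Q W _ (hW X)
  have : IsIso (Functor.whiskerRight adj.unit W.Q) := NatIso.isIso_of_isIso_app _
  let e : W.Localization ≌ D := CategoryTheory.Equivalence.mk (Localization.lift G hG W.Q) (F ⋙ W.Q)
    (Localization.liftNatIso W.Q W W.Q (G ⋙ F ⋙ W.Q) _ _
      (W.Q.leftUnitor.symm ≪≫ asIso (Functor.whiskerRight adj.unit W.Q)))
    (Functor.associator _ _ _ ≪≫ Functor.isoWhiskerLeft _ (Localization.fac G hG W.Q) ≪≫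
      asIso adj.counit)
  exact Functor.IsLocalization.of_equivalence_target W.Q W G e (Localization.fac G hG W.Q)

namespace C2

variable {X : C2}

/-- The unit is a Cauchy morphism. For the cylinder, the Cauchy development is everything, and the
surface is part of the definition of an object. -/
lemma cauchyMorphisms_toCompletion (X : C2) : cauchyMorphisms X.toCompletion := by
  have himg : image (map X.toCompletion) = X.carrier := X.image_inclusion
  rw [cauchyMorphisms, himg]
  cases hX : X.background with
  | minkowski =>
    refine ⟨_, ?_, X.isCauchySurface_balance hX⟩
    rintro - ⟨x, ⟨hx, -⟩, rfl⟩
    exact hx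
  | cylinder =>
    obtain ⟨S, hS, hS'⟩ := X.cauchy hX
    refine ⟨S, hS, ?_⟩
    have : X.completion.carrier = univ := by
      change cauchyDevelopment X.carrier = univ
      rw [cauchyDevelopment_carrier, X.plus_eq_univ hX, X.minus_eq_univ hX, univ_prod_univ,
        image_univ, X.background.proj_surjective.range_eq]
    rw [this]
    exact hS'

/-- The Cauchy development of an object, as an object of the full subcategory of stable
objects. -/
def stableCompletion (X : C2) : cauchyStable.FullSubcategory :=
  ⟨X.completion, X.cauchyStable_completion⟩

/-- The universal property of the inclusion of an object into its Cauchy development. -/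
def completionHomEquiv (X : C2) (Z : cauchyStable.FullSubcategory) :
    (X.stableCompletion ⟶ Z) ≃ (X ⟶ cauchyStable.ι.obj Z) :=
  Equiv.ofBijective (fun g => X.toCompletion ≫ g.hom) ⟨fun g g' h =>
    ObjectProperty.hom_ext _ (toCompletion_comp_injective h), fun f => by
    obtain ⟨g, hg⟩ := exists_toCompletion_comp_eq f Z.property
    exact ⟨ObjectProperty.homMk g, hg⟩⟩

lemma completionHomEquiv_comp (X : C2) (Z Z' : cauchyStable.FullSubcategory) (g : Z ⟶ Z')
    (h : X.stableCompletion ⟶ Z) :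
    X.completionHomEquiv Z' (h ≫ g) = X.completionHomEquiv Z h ≫ cauchyStable.ι.map g :=
  rfl

/-- Cauchy development as a functor. -/
def developmentFunctor : C2 ⥤ cauchyStable.FullSubcategory :=
  Adjunction.leftAdjointOfEquiv completionHomEquiv completionHomEquiv_comp

/-- Cauchy development is left adjoint to the inclusion of the stable objects. -/
def developmentAdjunction : developmentFunctor ⊣ cauchyStable.ι :=
  Adjunction.adjunctionOfEquivLeft completionHomEquiv completionHomEquiv_comp

lemma developmentAdjunction_unit_app (X : C2) :
    developmentAdjunction.unit.app X = X.toCompletion := by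
  simp [developmentAdjunction, Adjunction.adjunctionOfEquivLeft]
  rfl

lemma isInvertedBy_developmentFunctor : cauchyMorphisms.IsInvertedBy developmentFunctor := by
  intro X Y f hf
  have hnat := developmentAdjunction.unit.naturality f
  rw [developmentAdjunction_unit_app, developmentAdjunction_unit_app] at hnat
  rw [← ObjectProperty.isIso_hom_iff]
  exact isIso_of_cauchyMorphisms hf hnat.symm

/-! ### The stable objects -/

lemma exists_region_eq_doubleCone {Ip Im : Set ℝ} (hp : IsOpenInterval Ip)
    (hm : IsOpenInterval Im) : ∃ X : C2, X.region = doubleCone Ip Im ∧ cauchyStable X := by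
  have hpre : Background.minkowski.proj ⁻¹' (Background.minkowski.proj '' (Ip ×ˢ Im)) = Ip ×ˢ Im :=
    preimage_image_eq _ (Background.proj_injective rfl)
  let X : C2 :=
    { background := .minkowski
      carrier := Background.minkowski.proj '' (Ip ×ˢ Im)
      isOpen := Background.minkowski.isOpenMap_proj _ (hp.2.1.prod hm.2.1)
      isConnected := ⟨(hp.1.prod hm.1).image _, (_root_.IsPreconnected.prod
        hp.2.2.isPreconnected hm.2.2.isPreconnected).image _
          Background.minkowski.continuous_proj.continuousOn⟩
      causallyConvex := by
        refine isCausallyConvexIn_univ_of_ordConnected ?_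
        rw [hpre]
        exact ⟨fun a ha b hb c hc => ⟨hp.2.2.out ha.1 hb.1 ⟨hc.1.1, hc.2.1⟩,
          hm.2.2.out ha.2 hb.2 ⟨hc.1.2, hc.2.2⟩⟩⟩
      cauchy := by simp }
  refine ⟨X, rfl, cauchyStable_iff.2 ?_⟩
  have h1 : X.plus = Ip := by
    rw [plus, show X.cover = Ip ×ˢ Im from hpre, fst_image_prod _ hm.1]
  have h2 : X.minus = Im := by
    rw [minus, show X.cover = Ip ×ˢ Im from hpre, snd_image_prod hp.1]
  rw [cauchyDevelopment_carrier, h1, h2]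

lemma exists_region_eq_cylinder :
    ∃ X : C2, X.region = ⟨Background.cylinder, univ⟩ ∧ cauchyStable X := by
  let X : C2 :=
    { background := .cylinder
      carrier := univ
      isOpen := isOpen_univ
      isConnected := by
        rw [← Background.cylinder.proj_surjective.range_eq, ← image_univ]
        exact isConnected_univ.image _ Background.cylinder.continuous_proj.continuousOn
      causallyConvex := fun _ _ _ _ _ _ _ _ _ => trivial
      cauchy := fun _ => ⟨_, subset_univ _, isCauchySurface_time .cylinder 0⟩ }
  exact ⟨X, rfl, cauchyStable_iff.2 (univ_subset_iff.1 (subset_cauchyDevelopment univ))⟩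

lemma region_of_cauchyStable {X : C2} (h : cauchyStable X) :
    (∃ Ip Im : Set ℝ, IsOpenInterval Ip ∧ IsOpenInterval Im ∧ X.region = doubleCone Ip Im) ∨
      X.region = ⟨Background.cylinder, univ⟩ := by
  have hd : X.carrier = X.background.proj '' (X.plus ×ˢ X.minus) := by
    rw [← cauchyDevelopment_carrier, cauchyStable_iff.1 h]
  have hne := X.nonempty_cover
  have h1 : IsOpenInterval X.plus := ⟨hne.image _, X.isOpen_plus, X.ordConnected_plus⟩
  have h2 : IsOpenInterval X.minus := ⟨hne.image _, X.isOpen_minus, X.ordConnected_minus⟩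
  cases hX : X.background with
  | minkowski =>
    refine Or.inl ⟨X.plus, X.minus, h1, h2, ?_⟩
    have key : ∀ B : Background, B = .minkowski → ∀ S : Set (ℝ × ℝ),
        (⟨B, B.proj '' S⟩ : Region) = ⟨.minkowski, Background.minkowski.proj '' S⟩ := by
      rintro - rfl S
      rfl
    rw [region, hd, doubleCone]
    exact key _ hX _
  | cylinder =>
    refine Or.inr ?_
    rw [X.plus_eq_univ hX, X.minus_eq_univ hX, univ_prod_univ, image_univ,
      X.background.proj_surjective.range_eq] at hd
    rw [region, hd, hX]

end C2

end ConformalSpacetime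

end

theorem proposition3p3 :
    -- the objects of `C₂ᴰ` are exactly the double cones and the full cylinder
    (∀ R : ConformalSpacetime.Region,
      (∃ X : ConformalSpacetime.C2, X.region = R ∧ ConformalSpacetime.C2.cauchyStable X) ↔
        (∃ Ip Im : Set ℝ, ConformalSpacetime.C2.IsOpenInterval Ip ∧
          ConformalSpacetime.C2.IsOpenInterval Im ∧ R = ConformalSpacetime.C2.doubleCone Ip Im) ∨
        R = ⟨ConformalSpacetime.Background.cylinder, Set.univ⟩) ∧
    -- the inclusion of `C₂ᴰ` is fully faithful
    ConformalSpacetime.C2.cauchyStable.ι.Full ∧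
    ConformalSpacetime.C2.cauchyStable.ι.Faithful ∧
    -- and it has a left adjoint `D`
    ∃ (D : CategoryTheory.Functor ConformalSpacetime.C2
        ConformalSpacetime.C2.cauchyStable.FullSubcategory)
      (adj : CategoryTheory.Adjunction D ConformalSpacetime.C2.cauchyStable.ι),
      -- given on objects by Cauchy development
      (∀ X : ConformalSpacetime.C2, (D.obj X).obj.region = X.development) ∧
      -- such that the unit of the adjunction consists of the inclusions of subsets
      (∀ (X : ConformalSpacetime.C2) (p : X.carrier),
        ConformalSpacetime.C2.event (D.obj X).obj
          (ConformalSpacetime.C2.map (adj.unit.app X) p) = X.event p) ∧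
      -- and `D` is a localization functor at all Cauchy morphisms
      D.IsLocalization ConformalSpacetime.C2.cauchyMorphisms := by
  refine ⟨fun R => ⟨?_, ?_⟩, inferInstance, inferInstance,
    ConformalSpacetime.C2.developmentFunctor, ConformalSpacetime.C2.developmentAdjunction,
    fun X => rfl, fun X p => ?_, ?_⟩
  · rintro ⟨X, rfl, hX⟩
    exact ConformalSpacetime.C2.region_of_cauchyStable hX
  · rintro (⟨Ip, Im, hp, hm, rfl⟩ | rfl)
    · exact ConformalSpacetime.C2.exists_region_eq_doubleCone hp hm
    · exact ConformalSpacetime.C2.exists_region_eq_cylinder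
  · rw [ConformalSpacetime.C2.developmentAdjunction_unit_app]
    rfl
  · refine ConformalSpacetime.isLocalization_of_unit ConformalSpacetime.C2.developmentAdjunction _
      ConformalSpacetime.C2.isInvertedBy_developmentFunctor fun X => ?_
    rw [ConformalSpacetime.C2.developmentAdjunction_unit_app]
    exact ConformalSpacetime.C2.cauchyMorphisms_toCompletion X
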